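/- Let $R\ge 1$, $K\ge 1$, $T=2R$, let $L_1,\dots,L_K$ be positive integers, let $u_{t\nu}\in\{1,\dots,L_\nu-1\}$ for $1\le t\le 2R$, $1\le \nu\le K$, and put $$\mathbf D_\nu=\mathrm{diag}\bigl(e^{2\pi \mathrm{i}\,u_{1\nu}/L_\nu},\dots,e^{2\pi \mathrm{i}\,u_{2R,\nu}/L_\nu}\bigr),\qquad \mathbf D^{l}=\prod_{\nu=1}^K\mathbf D_\nu^{l_\nu}$$ for $l=(l_1,\dots,l_K)$ with $1\le l_\nu\le L_\nu$. Let $\mathbf M$ be an $R\times R$ generalized Butson--Hadamard matrix, i.e. $\mathbf M\mathbf M^H=\mathbf M^H\mathbf M=R\,\mathbf I_R$ and $m_{ij}^*=m_{ij}^{-1}$ for all entries; let $\mathbf\Gamma=[\mathbf M^T\ \mathbf M^T]^T$, $\mathbf A_j=\mathrm{diag}(\mathbf\Gamma_{1j},\dots,\mathbf\Gamma_{2R,j})$ and $\mathbf x=\frac1{\sqrt{2R}}[1\,\cdots\,1]^T$. The non-differential abelian distributed space-time block code has the codewords $\mathbf S_l=[\mathbf A_1\mathbf D^l\mathbf x\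 \cdots\ \mathbf A_R\mathbf D^l\mathbf x]=\frac1{\sqrt{2R}}\mathbf D^l\mathbf\Gamma$. It is used in a network with one source, $R$ relays and one destination. For a message $l$, uniformly distributed, relay $j$ receives $\mathbf r_j=\sqrt{P_1T}\,f_j\mathbf D^l\mathbf x+\mathbf n_j$ and sends $\mathbf t_j=\sqrt{P_2/(1+P_1)}\,\mathbf A_j\mathbf r_j$, and the destination receives $\mathbf y=\sum_j g_j\mathbf t_j+\mathbf w$; all $f_j$, $g_j$ and all entries of $\mathbf n_j$, $\mathbf w$ are independent circularly symmetric complex Gaussian variables with mean $0$ and variance $1$. The destination knows the $g_j$ but not the $f_j$, and uses a maximum-likelihood decoder, i.e. it returns a message maximizing the conditional density of $\mathbf y$ given $\mathbf S_l$ and $(g_j)$, ties being broken in any measurable way. The total power $P=P_1+RP_2$ is shared in a fixed proportion, $P_1=\alpha P$, $P_2=(1-\alpha)P/R$ with $0<\alpha<1$. The diversity order is $d$ if the block error rate $P_e(P)$ is positive for all large $P$ and $-\log P_e(P)/\log P\to d$ as $P\to\infty$. Then the diversity order is $R$ if and only if, for each $i=1,\dots,R$ and all $l\ne\hat l$, $$\sum_{\nu=1}^K\frac{(l_\nu-\hat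 l_\nu)(u_{i\nu}-u_{(R+i)\nu})}{L_\nu}\notin\mathbb Z .$$ The same condition is also necessary and sufficient for the determinant criterion: $\det(\mathbf S_{l\hat l}^H\mathbf S_{l\hat l})\neq0$ for all $l\ne\hat l$, where $\mathbf S_{l\hat l}=[\mathbf S_l\ \mathbf S_{\hat l}]$. -/

import Mathlib

open MeasureTheory ProbabilityTheory Filter Topology

noncomputable section

namespace RelayNetwork

/-! ### The code

With `R` relays a codeword lasts `T = 2R` channel uses. These `2R` coordinates are indexed by
`Fin R ⊕ Fin R`: the coordinate `i ≤ R` is `Sum.inl i`, the coordinate `R + i` is `Sum.inr i`. -/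

/-- The `2R` coordinates (channel uses). -/
abbrev Slot (R : ℕ) := Fin R ⊕ Fin R

/-- Multi-indices `l = (l₁, …, l_K)` with `1 ≤ l_ν ≤ L_ν`; the value `l_ν` is `(l ν : ℕ) + 1`. -/
abbrev Message {K : ℕ} (L : Fin K → ℕ) := (ν : Fin K) → Fin (L ν)

/-- Generalized Butson-Hadamard matrices: `M Mᴴ = Mᴴ M = R I`, and the conjugate of every entry
is its inverse. -/
structure IsGBH {R : ℕ} (M : Matrix (Fin R) (Fin R) ℂ) : Prop where
  mul_conjTranspose : M * M.conjTranspose = (R : ℂ) • (1 : Matrix (Fin R) (Fin R) ℂ)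
  conjTranspose_mul : M.conjTranspose * M = (R : ℂ) • (1 : Matrix (Fin R) (Fin R) ℂ)
  entry_mul_conj : ∀ i j, M i j * star (M i j) = 1

/-- The `2R × R` matrix `Γ = [Mᵀ Mᵀ]ᵀ`. -/
def gammaMatrix {R : ℕ} (M : Matrix (Fin R) (Fin R) ℂ) : Matrix (Slot R) (Fin R) ℂ :=
  Matrix.fromRows M M

/-- The matrix `A_j = diag (Γ_{1j}, …, Γ_{2R,j})` of the `j`-th relay. -/
def relayMatrix {R : ℕ} (M : Matrix (Fin R) (Fin R) ℂ) (j : Fin R) :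
    Matrix (Slot R) (Slot R) ℂ :=
  Matrix.diagonal fun t => gammaMatrix M t j

/-- The generator `D_ν = diag (exp (2πi u_{1ν} / L_ν), …, exp (2πi u_{2R,ν} / L_ν))`. -/
def generator {R K : ℕ} (L : Fin K → ℕ) (u : Slot R → Fin K → ℕ) (ν : Fin K) :
    Matrix (Slot R) (Slot R) ℂ :=
  Matrix.diagonal fun t => Complex.exp (2 * Real.pi * Complex.I * (u t ν : ℂ) / (L ν : ℂ))

/-- The group element `D^l = D₁^{l₁} ⋯ D_K^{l_K}`. -/
def groupElement {R K : ℕ} (L : Fin K → ℕ) (u : Slot R → Fin K → ℕ) (l : Message L) :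
    Matrix (Slot R) (Slot R) ℂ :=
  (List.ofFn fun ν : Fin K => generator L u ν ^ ((l ν : ℕ) + 1)).prod

/-- The vector `x = (1, …, 1)ᵀ / √(2R)`. -/
def xVector (R : ℕ) : Slot R → ℂ := fun _ => 1 / (Real.sqrt (2 * R) : ℂ)

/-- The vector `D^l x` which the source transmits for the message `l`. -/
def sourceVector {R K : ℕ} (L : Fin K → ℕ) (u : Slot R → Fin K → ℕ) (l : Message L) :
    Slot R → ℂ :=
  (groupElement L u l).mulVec (xVector R)

/-- The codeword `S_l = [A₁ D^l x  ⋯  A_R D^l x]`, a `2R × R` matrix. -/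
def codeword {R K : ℕ} (L : Fin K → ℕ) (u : Slot R → Fin K → ℕ)
    (M : Matrix (Fin R) (Fin R) ℂ) (l : Message L) : Matrix (Slot R) (Fin R) ℂ :=
  Matrix.of fun t j => (relayMatrix M j).mulVec (sourceVector L u l) t

/-- The determinant criterion: `|S_{l l'}ᴴ S_{l l'}| ≠ 0` for the juxtaposition
`S_{l l'} = [S_l  S_{l'}]` of any two codewords with `l ≠ l'`. -/
def DetCriterion {R K : ℕ} (L : Fin K → ℕ) (u : Slot R → Fin K → ℕ)
    (M : Matrix (Fin R) (Fin R) ℂ) : Prop :=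
  ∀ l l' : Message L, l ≠ l' →
    ((Matrix.fromCols (codeword L u M l) (codeword L u M l')).conjTranspose *
      Matrix.fromCols (codeword L u M l) (codeword L u M l')).det ≠ 0

/-! ### The channel -/

/-- The law of a circularly symmetric complex Gaussian variable of mean `0` and variance `1`:
real and imaginary parts are independent real Gaussians of mean `0` and variance `1/2`. -/
def cscg : Measure ℂ :=
  ((gaussianReal 0 (1 / 2)).prod (gaussianReal 0 (1 / 2))).map
    fun p : ℝ × ℝ => (⟨p.1, p.2⟩ : ℂ)

/-- The random quantities: source-relay fadings `f`, relay-destination fadings `g`, the noise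
vectors `n_j` at the relays, and the noise vector `w` at the destination. -/
abbrev Sample (R : ℕ) :=
  (Fin R → ℂ) × (Fin R → ℂ) × (Fin R → Slot R → ℂ) × (Slot R → ℂ)

/-- All these complex variables are independent and standard circularly symmetric Gaussian. -/
def sampleLaw (R : ℕ) : Measure (Sample R) :=
  (Measure.pi fun _ : Fin R => cscg).prod
    ((Measure.pi fun _ : Fin R => cscg).prod
      ((Measure.pi fun _ : Fin R => Measure.pi fun _ : Slot R => cscg).prod
        (Measure.pi fun _ : Slot R => cscg)))

/-- The fadings `g` from the relays to the destination. -/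
def destFading {R : ℕ} (ω : Sample R) : Fin R → ℂ := ω.2.1

/-- First phase: the `j`-th relay receives `r_j = √(P₁ T) f_j s + n_j`, where `T = 2R`. -/
def relayReceived {R : ℕ} (P₁ : ℝ) (s : Slot R → ℂ) (ω : Sample R) (j : Fin R) :
    Slot R → ℂ :=
  ((Real.sqrt (P₁ * (2 * R)) : ℂ) * ω.1 j) • s + ω.2.2.1 j

/-- Second phase: the `j`-th relay sends `t_j = √(P₂ / (1 + P₁)) A_j r_j`. -/
def relayTransmitted {R : ℕ} (P₁ P₂ : ℝ) (M : Matrix (Fin R) (Fin R) ℂ) (s : Slot R → ℂ)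
    (ω : Sample R) (j : Fin R) : Slot R → ℂ :=
  (Real.sqrt (P₂ / (1 + P₁)) : ℂ) • (relayMatrix M j).mulVec (relayReceived P₁ s ω j)

/-- The destination receives `y = ∑ j, g_j t_j + w`. -/
def destReceived {R : ℕ} (P₁ P₂ : ℝ) (M : Matrix (Fin R) (Fin R) ℂ) (s : Slot R → ℂ)
    (ω : Sample R) : Slot R → ℂ :=
  ∑ j, destFading ω j • relayTransmitted P₁ P₂ M s ω j + ω.2.2.2

/-! ### Partially-coherent maximum-likelihood decoding and error rate -/

/-- The covariance `Σ_y = ρ S Σ_h Sᴴ + γ I` of the received vector given `S` and `g`, where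
`ρ = P₁ P₂ T / (P₁ + 1)`, `Σ_h = diag (|g₁|², …, |g_R|²)` and
`γ = 1 + P₂ / (1 + P₁) ∑ j, |g_j|²`. -/
def receivedCov {R : ℕ} (P₁ P₂ : ℝ) (S : Matrix (Slot R) (Fin R) ℂ) (g : Fin R → ℂ) :
    Matrix (Slot R) (Slot R) ℂ :=
  ((P₁ * P₂ * (2 * R) / (P₁ + 1) : ℝ) : ℂ) •
      (S * Matrix.diagonal (fun j => ((‖g j‖ ^ 2 : ℝ) : ℂ)) * S.conjTranspose) +
    ((1 + P₂ / (1 + P₁) * ∑ j, ‖g j‖ ^ 2 : ℝ) : ℂ) • (1 : Matrix (Slot R) (Slot R) ℂ)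

/-- The Gaussian density `exp (- yᴴ Σ_y⁻¹ y) / (π^T |Σ_y|)` of the received vector given the
codeword and `g` (the fadings `f` are unknown to the destination). -/
def likelihood {R : ℕ} (P₁ P₂ : ℝ) (S : Matrix (Slot R) (Fin R) ℂ) (g : Fin R → ℂ)
    (y : Slot R → ℂ) : ℝ :=
  Real.exp (-(dotProduct (star y) ((receivedCov P₁ P₂ S g)⁻¹.mulVec y)).re) /
    (Real.pi ^ (2 * R) * (receivedCov P₁ P₂ S g).det.re)

/-- A decoder, which sees `g` and `y`, is a maximum-likelihood decoder if it always returns a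
message whose codeword maximizes the likelihood. Ties may be broken in any measurable way. -/
structure IsMLDecoder {R K : ℕ} (P₁ P₂ : ℝ) (L : Fin K → ℕ) (u : Slot R → Fin K → ℕ)
    (M : Matrix (Fin R) (Fin R) ℂ) (dec : (Fin R → ℂ) → (Slot R → ℂ) → Message L) :
    Prop where
  measurable : Measurable (Function.uncurry dec)
  maximizes : ∀ g y l, likelihood P₁ P₂ (codeword L u M l) g y ≤
    likelihood P₁ P₂ (codeword L u M (dec g y)) g y

/-- The block error rate: the probability that the decoded message differs from the transmitted
one, which is uniformly distributed over the messages. -/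
def blockErrorRate {R K : ℕ} (P₁ P₂ : ℝ) (L : Fin K → ℕ) (u : Slot R → Fin K → ℕ)
    (M : Matrix (Fin R) (Fin R) ℂ) (dec : (Fin R → ℂ) → (Slot R → ℂ) → Message L) : ℝ :=
  (∑ l : Message L, (sampleLaw R).real
      {ω | dec (destFading ω) (destReceived P₁ P₂ M (sourceVector L u l) ω) ≠ l}) /
    (Fintype.card (Message L) : ℝ)

/-- An error probability `p`, as a function of the total power `P`, has diversity order `d` if
`- log p(P) / log P` tends to `d` as `P → ∞`. -/
def HasDiversityOrder (p : ℝ → ℝ) (d : ℝ) : Prop :=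
  (∀ᶠ P in atTop, 0 < p P) ∧
    Tendsto (fun P => -Real.log (p P) / Real.log P) atTop (𝓝 d)

/-- The power `P₁ = α P` of the source when it gets the share `α` of the total power. -/
def sourcePower (α P : ℝ) : ℝ := α * P

/-- The power `P₂ = (1 - α) P / R` of each relay, so that `P₁ + R P₂ = P`. -/
def relayPower (R : ℕ) (α P : ℝ) : ℝ := (1 - α) * P / R

end RelayNetwork

end

open RelayNetwork

/-!
Maximizing the Gaussian likelihood amounts to minimizing a regularized least-squares cost over the
faded symbols `g_j f_j`. If the `2 × 2` block determinants of two messages do not vanish, the two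
least-squares problems are uniformly separated, so an error forces every product `g_j f_j` to be of
size `P ^ (-1/2 + o(1))` unless the sample is exceptionally large; independence of the `R` relays
gives an error rate of at most `P ^ (-R + o(1))`.

Conversely, a volume-preserving map of the samples turns the reception of one message into that of
another. It leaves the decoder's input unchanged and moves the noise only in the blocks whose
determinant does not vanish, by an amount that stays bounded when the faded symbols of these
`n` blocks are at most `P ^ (-1/2)`. This happens with probability about `P ^ (-n)`, and one of the
two messages is then decoded incorrectly. Any two messages have `n ≤ R`, and `n ≤ R - 1` for some
pair unless all block determinants are nonzero.
-/

noncomputable section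

open scoped ComplexOrder

namespace RelayNetwork

/-! ### Algebra of the code -/

section Determinants

open Matrix

variable {n α : Type*} [Fintype n] [DecidableEq n] [CommRing α]

lemma prod_ofFn_diagonal {K : ℕ} (d : Fin K → n → α) :
    (List.ofFn fun ν => diagonal (d ν)).prod = diagonal (∏ ν, d ν) := by
  have h := map_list_prod (diagonalRingHom n α) (List.ofFn d)
  rw [List.prod_ofFn, List.map_ofFn] at h
  exact h.symm

lemma det_fromBlocks_diagonal (a b c d : n → α) :
    (fromBlocks (diagonal a) (diagonal b) (diagonal c) (diagonal d)).det =
      ∏ i, (a i * d i - b i * c i) := by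
  let e : n ⊕ n ≃ Fin 2 × n :=
    (Equiv.boolProdEquivSum n).symm.trans (finTwoEquiv.symm.prodCongr (Equiv.refl n))
  have h : fromBlocks (diagonal a) (diagonal b) (diagonal c) (diagonal d) =
      (blockDiagonal fun i => !![a i, b i; c i, d i]).submatrix e e := by
    ext (i | i) (j | j) <;> simp [e, finTwoEquiv, blockDiagonal_apply, diagonal_apply]
  rw [h, det_submatrix_equiv_self, det_blockDiagonal]
  simp only [det_fin_two_of]

end Determinants

section Code

variable {R K : ℕ} {L : Fin K → ℕ} {u : Slot R → Fin K → ℕ} {M : Matrix (Fin R) (Fin R) ℂ}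

variable (L u) in
/-- The diagonal entry of the group element `D^l` in the coordinate `t`. -/
def phase (l : Message L) (t : Slot R) : ℂ :=
  ∏ ν, Complex.exp (2 * Real.pi * Complex.I * (u t ν : ℂ) / (L ν : ℂ)) ^ ((l ν : ℕ) + 1)

lemma groupElement_eq (l : Message L) :
    groupElement L u l = Matrix.diagonal (phase L u l) := by
  simp only [groupElement, generator, Matrix.diagonal_pow, prod_ofFn_diagonal]
  congr 1
  ext t
  simp [phase]

lemma phase_eq_exp (l : Message L) (t : Slot R) :
    phase L u l t = Complex.exp (2 * Real.pi * Complex.I *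
      ((∑ ν, (((l ν : ℕ) : ℝ) + 1) * (u t ν : ℝ) / (L ν : ℝ) : ℝ) : ℂ)) := by
  simp only [phase, ← Complex.exp_nat_mul, ← Complex.exp_sum]
  congr 1
  push_cast
  rw [Finset.mul_sum]
  refine Finset.sum_congr rfl fun ν _ => ?_
  ring

lemma norm_phase (l : Message L) (t : Slot R) : ‖phase L u l t‖ = 1 := by
  rw [phase_eq_exp, Complex.norm_exp]
  simp

lemma phase_ne_zero (l : Message L) (t : Slot R) : phase L u l t ≠ 0 :=
  norm_ne_zero_iff.1 (by rw [norm_phase]; exact one_ne_zero)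

variable (L u) in
/-- The determinant of the `2 × 2` matrix formed by the entries of `D^l` and `D^{l'}` in the
coordinates `i` and `R + i`. It vanishes iff the pairs of entries of the two codewords in these
coordinates span the same line. -/
def blockDet (l l' : Message L) (i : Fin R) : ℂ :=
  phase L u l (Sum.inl i) * phase L u l' (Sum.inr i) -
    phase L u l' (Sum.inl i) * phase L u l (Sum.inr i)

lemma blockDet_eq_zero_iff (l l' : Message L) (i : Fin R) :
    blockDet L u l l' i = 0 ↔
      ∃ z : ℤ, ∑ ν, (((l ν : ℕ) : ℝ) - ((l' ν : ℕ) : ℝ)) *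
          ((u (Sum.inl i) ν : ℝ) - (u (Sum.inr i) ν : ℝ)) / (L ν : ℝ) = (z : ℝ) := by
  rw [blockDet, sub_eq_zero]
  simp only [phase_eq_exp, ← Complex.exp_add, ← mul_add, ← Complex.ofReal_add,
    Complex.exp_eq_exp_iff_exists_int]
  refine exists_congr fun z => ?_
  rw [← mul_comm (2 * Real.pi * Complex.I), ← mul_add,
    mul_right_inj' Complex.two_pi_I_ne_zero, ← Complex.ofReal_intCast, ← Complex.ofReal_add,
    Complex.ofReal_inj, ← sub_eq_iff_eq_add', ← Finset.sum_add_distrib,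
    ← Finset.sum_add_distrib, ← Finset.sum_sub_distrib]
  exact Eq.congr_left (Finset.sum_congr rfl fun ν _ => by ring)

lemma sourceVector_apply (l : Message L) (t : Slot R) :
    sourceVector L u l t = phase L u l t / (√(2 * R) : ℂ) := by
  simp [sourceVector, groupElement_eq, Matrix.mulVec_diagonal, xVector, div_eq_mul_inv]

lemma relayMatrix_mulVec (j : Fin R) (x : Slot R → ℂ) (t : Slot R) :
    (relayMatrix M j).mulVec x t = gammaMatrix M t j * x t := by
  simp [relayMatrix, Matrix.mulVec_diagonal]

lemma codeword_eq (l : Message L) :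
    codeword L u M l =
      (√(2 * R) : ℂ)⁻¹ • (Matrix.diagonal (phase L u l) * gammaMatrix M) := by
  ext t j
  simp only [codeword, Matrix.of_apply, relayMatrix_mulVec, sourceVector_apply,
    Matrix.smul_apply, Matrix.diagonal_mul, smul_eq_mul]
  ring

lemma sqrt_two_mul_ne_zero (hR : 0 < R) : (√(2 * R) : ℂ) ≠ 0 := by
  have : √(2 * R) ≠ 0 := by positivity
  exact_mod_cast this

lemma fromCols_codeword (l l' : Message L) :
    Matrix.fromCols (codeword L u M l) (codeword L u M l') =
      (√(2 * R) : ℂ)⁻¹ •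
        (Matrix.fromBlocks
          (Matrix.diagonal fun i => phase L u l (Sum.inl i))
          (Matrix.diagonal fun i => phase L u l' (Sum.inl i))
          (Matrix.diagonal fun i => phase L u l (Sum.inr i))
          (Matrix.diagonal fun i => phase L u l' (Sum.inr i)) *
        Matrix.fromBlocks M 0 0 M) := by
  rw [codeword_eq, codeword_eq, Matrix.fromBlocks_multiply]
  ext (s | s) (t | t) <;> simp [gammaMatrix]

lemma det_fromCols_codeword (l l' : Message L) :
    (Matrix.fromCols (codeword L u M l) (codeword L u M l')).det =
      (√(2 * R) : ℂ)⁻¹ ^ (R + R) * ((∏ i, blockDet L u l l' i) * M.det ^ 2) := by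
  rw [fromCols_codeword, Matrix.det_smul, Matrix.det_mul, det_fromBlocks_diagonal,
    Matrix.det_fromBlocks_zero₁₂, ← sq, Fintype.card_sum, Fintype.card_fin]
  rfl

theorem detCriterion_iff (hR : 0 < R) (hM : M.det ≠ 0) :
    DetCriterion L u M ↔ ∀ l l' : Message L, l ≠ l' → ∀ i, blockDet L u l l' i ≠ 0 := by
  refine forall₃_congr fun l l' _ => ?_
  rw [Matrix.det_mul, Matrix.det_conjTranspose, mul_ne_zero_iff, star_ne_zero, and_self,
    det_fromCols_codeword]
  simp only [mul_ne_zero_iff, pow_ne_zero _ (inv_ne_zero (sqrt_two_mul_ne_zero hR)),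
    pow_ne_zero _ hM, Finset.prod_ne_zero_iff, ne_eq, not_false_eq_true, true_and, and_true,
    Finset.mem_univ, forall_const]

lemma IsGBH.det_ne_zero (hM : IsGBH M) : M.det ≠ 0 := by
  refine left_ne_zero_of_mul (b := M.conjTranspose.det) ?_
  rw [← Matrix.det_mul, hM.mul_conjTranspose, Matrix.det_smul, Matrix.det_one, mul_one,
    Fintype.card_fin]
  exact_mod_cast (Nat.pow_self_pos (n := R)).ne'

lemma nontrivial_message (hK : 0 < K) (hL : ∀ ν, 2 ≤ L ν) : Nontrivial (Message L) := by
  have : ∀ ν, Nontrivial (Fin (L ν)) := fun ν => Fin.nontrivial_iff_two_le.2 (hL ν)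
  exact Pi.nontrivial_at ⟨0, hK⟩

end Code

/-! ### Estimates for Gaussian and product measures -/

section Measures

variable {α β ι : Type*} [MeasurableSpace α] [MeasurableSpace β] [Fintype ι]

lemma measureReal_le_lintegral_div {μ : Measure α} {φ : α → ENNReal} (hφ : AEMeasurable φ μ)
    (hfin : ∫⁻ x, φ x ∂μ ≠ ⊤) {A : Set α} {a : ℝ} (ha : 0 < a)
    (hA : ∀ x ∈ A, ENNReal.ofReal a ≤ φ x) : μ.real A ≤ (∫⁻ x, φ x ∂μ).toReal / a := by
  have ha' : ENNReal.ofReal a ≠ 0 := (ENNReal.ofReal_pos.2 ha).ne'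
  have h : μ A ≤ (∫⁻ x, φ x ∂μ) / ENNReal.ofReal a :=
    (measure_mono hA).trans (meas_ge_le_lintegral_div hφ ha' ENNReal.ofReal_ne_top)
  simpa [Measure.real, ENNReal.toReal_ofReal ha.le] using
    ENNReal.toReal_mono (ENNReal.div_ne_top hfin ha') h

lemma smul_restrict_pi_le {μ ν : Measure α} [SigmaFinite μ] {c : ENNReal} {A : Set α}
    (h : c • μ.restrict A ≤ ν) :
    (c ^ Fintype.card ι) • (Measure.pi fun _ : ι => μ).restrict (Set.univ.pi fun _ => A) ≤
      Measure.pi fun _ : ι => ν := by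
  refine Measure.le_iff.2 fun s hs => ?_
  conv_rhs => rw [Measure.pi, toMeasure_apply _ _ hs]
  suffices hle : ((c ^ Fintype.card ι) • (Measure.pi fun _ : ι => μ).restrict
      (Set.univ.pi fun _ => A)).toOuterMeasure ≤
      OuterMeasure.pi fun _ : ι => ν.toOuterMeasure from hle s
  refine OuterMeasure.le_pi.2 fun t _ => ?_
  calc ((c ^ Fintype.card ι) • (Measure.pi fun _ : ι => μ).restrict (Set.univ.pi fun _ => A))
        (Set.univ.pi t) = ∏ i, (c • μ.restrict A) (t i) := by
        simp [Measure.restrict_pi_pi, Measure.pi_pi, Finset.prod_mul_distrib]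
    _ ≤ ∏ i, ν (t i) := Finset.prod_le_prod' fun i _ => h (t i)

lemma measureReal_prod_pi_forall_mem (μ : Measure α) (ν : Measure β) [SigmaFinite μ]
    [SigmaFinite ν] (S : Set (α × β)) :
    ((Measure.pi fun _ : ι => μ).prod (Measure.pi fun _ : ι => ν)).real
      {p | ∀ j, (p.1 j, p.2 j) ∈ S} = (μ.prod ν).real S ^ Fintype.card ι := by
  have h := measurePreserving_arrowProdEquivProdArrow α β ι (fun _ => μ) (fun _ => ν)
  have hS : MeasurableEquiv.arrowProdEquivProdArrow α β ι ⁻¹' {p | ∀ j, (p.1 j, p.2 j) ∈ S} =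
      Set.univ.pi fun _ : ι => S := by
    ext p
    simp [MeasurableEquiv.arrowProdEquivProdArrow, Equiv.arrowProdEquivProdArrow]
  rw [Measure.real, ← h.measure_preimage_equiv, hS, Measure.pi_pi]
  simp [Measure.real]

end Measures

section Gaussian

instance isGaussian_pi {ι E : Type*} [Fintype ι] [NormedAddCommGroup E] [NormedSpace ℝ E]
    [MeasurableSpace E] [BorelSpace E] [CompleteSpace E] [SecondCountableTopology E]
    (μ : Measure E) [IsGaussian μ] : IsGaussian (Measure.pi fun _ : ι => μ) := by
  have hid : ∀ _ : ι, AEMeasurable (fun x : E => x) μ := fun _ => aemeasurable_id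
  have h := (iIndepFun_pi hid).hasGaussianLaw fun i => ⟨by
    rw [(measurePreserving_eval (fun _ : ι => μ) i).map_eq]; infer_instance⟩
  simpa using h.isGaussian_map

lemma exists_measureReal_norm_gt_le {E : Type*} [NormedAddCommGroup E] [NormedSpace ℝ E]
    [MeasurableSpace E] [BorelSpace E] [CompleteSpace E] [SecondCountableTopology E]
    (μ : Measure E) [IsGaussian μ] (k : ℕ) :
    ∃ C : ℝ, ∀ X : ℝ, 0 < X → μ.real {x | X < ‖x‖} ≤ C / X ^ k := by
  have hint : Integrable (fun x => ‖x‖ ^ k) μ :=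
    (IsGaussian.memLp_id μ k (ENNReal.natCast_ne_top k)).integrable_norm_pow'
  refine ⟨_, fun X hX => measureReal_le_lintegral_div (by fun_prop) hint.lintegral_lt_top.ne
    (pow_pos hX k) fun x (hx : X < ‖x‖) => ENNReal.ofReal_le_ofReal ?_⟩
  gcongr

instance : IsProbabilityMeasure cscg :=
  Measure.isProbabilityMeasure_map Complex.measurableEquivRealProd.symm.measurable.aemeasurable

instance : IsGaussian cscg :=
  isGaussian_map_equiv (μ := (gaussianReal 0 (1 / 2)).prod (gaussianReal 0 (1 / 2)))
    Complex.equivRealProdCLM.symm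

instance (R : ℕ) : IsProbabilityMeasure (sampleLaw R) := by
  unfold sampleLaw; infer_instance

instance (R : ℕ) : BorelSpace (Sample R) := Prod.borelSpace

set_option synthInstance.maxSize 512 in
instance (R : ℕ) : IsGaussian (sampleLaw R) := by
  unfold sampleLaw; infer_instance

lemma gaussianPDF_half_mul (a b : ℝ) :
    gaussianPDF 0 (1 / 2) a * gaussianPDF 0 (1 / 2) b =
      ENNReal.ofReal (Real.pi⁻¹ * Real.exp (-(a ^ 2 + b ^ 2))) := by
  have hπ : (Real.sqrt Real.pi)⁻¹ * (Real.sqrt Real.pi)⁻¹ = Real.pi⁻¹ := by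
    rw [← mul_inv, Real.mul_self_sqrt Real.pi_pos.le]
  have h₁ : 2 * Real.pi * ((1 / 2 : NNReal) : ℝ) = Real.pi := by push_cast; ring
  have h₂ : 2 * ((1 / 2 : NNReal) : ℝ) = 1 := by push_cast; ring
  simp only [gaussianPDF, gaussianPDFReal]
  rw [← ENNReal.ofReal_mul (by positivity), h₁, h₂, mul_mul_mul_comm, hπ, ← Real.exp_add]
  congr 3
  ring

lemma cscg_eq_withDensity :
    cscg = volume.withDensity fun z : ℂ => ENNReal.ofReal (Real.pi⁻¹ * Real.exp (-‖z‖ ^ 2)) := by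
  have hprod : (gaussianReal 0 (1 / 2)).prod (gaussianReal 0 (1 / 2)) =
      volume.withDensity fun p : ℝ × ℝ =>
        gaussianPDF 0 (1 / 2) p.1 * gaussianPDF 0 (1 / 2) p.2 := by
    rw [gaussianReal_of_var_ne_zero _ (by norm_num : (1 / 2 : NNReal) ≠ 0),
      prod_withDensity (measurable_gaussianPDF _ _) (measurable_gaussianPDF _ _)]
    rfl
  have hm : Measurable fun p : ℝ × ℝ => (⟨p.1, p.2⟩ : ℂ) :=
    Complex.measurableEquivRealProd.symm.measurable
  have hvol := Complex.volume_preserving_equiv_real_prod.symm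
  ext s hs
  rw [cscg, hprod, Measure.map_apply hm hs, withDensity_apply _ (hm hs), withDensity_apply _ hs,
    ← hvol.setLIntegral_comp_preimage_emb
      Complex.measurableEquivRealProd.symm.measurableEmbedding]
  refine setLIntegral_congr_fun (hm hs) fun p _ => ?_
  have hnorm : ‖Complex.measurableEquivRealProd.symm p‖ ^ 2 = p.1 ^ 2 + p.2 ^ 2 := by
    rw [Complex.sq_norm, Complex.normSq_apply, sq, sq]
    rfl
  simp only [gaussianPDF_half_mul, hnorm]

lemma exists_smul_restrict_le_cscg (r : ℝ) :
    ∃ c : ENNReal, c ≠ 0 ∧ c ≠ ⊤ ∧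
      c • volume.restrict (Metric.closedBall (0 : ℂ) r) ≤ cscg := by
  refine ⟨ENNReal.ofReal (Real.pi⁻¹ * Real.exp (-r ^ 2)), ?_, ENNReal.ofReal_ne_top,
    Measure.le_iff.2 fun s hs => ?_⟩
  · exact (ENNReal.ofReal_pos.2 (by positivity)).ne'
  have hB : MeasurableSet (Metric.closedBall (0 : ℂ) r) := Metric.isClosed_closedBall.measurableSet
  rw [Measure.smul_apply, cscg_eq_withDensity, withDensity_apply _ hs,
    Measure.restrict_apply hs, smul_eq_mul, ← setLIntegral_const]
  refine (setLIntegral_mono' (hs.inter hB) fun z hz => ?_).trans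
    (lintegral_mono_set Set.inter_subset_left)
  have hz' : ‖z‖ ≤ r := by simpa using hz.2
  refine ENNReal.ofReal_le_ofReal ?_
  gcongr

lemma integrable_norm_rpow_mul_exp_neg_sq {s : ℝ} (hs : s < 2) :
    Integrable fun z : ℂ => ‖z‖ ^ (-s) * Real.exp (-‖z‖ ^ 2) := by
  have h := Complex.integral_rpow_mul_exp_neg_rpow (p := 2) (q := -s) (by norm_num) (by linarith)
  simp only [Real.rpow_two] at h
  refine Integrable.of_integral_ne_zero (h ▸ ne_of_gt ?_)
  have := Real.Gamma_pos_of_pos (show 0 < (-s + 2) / 2 by linarith)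
  positivity

lemma lintegral_enorm_rpow_neg_cscg_ne_top {s : ℝ} (hs : s < 2) :
    ∫⁻ z, ‖z‖ₑ ^ (-s) ∂cscg ≠ ⊤ := by
  rw [cscg_eq_withDensity, lintegral_withDensity_eq_lintegral_mul _ (by fun_prop) (by fun_prop)]
  have hint := (integrable_norm_rpow_mul_exp_neg_sq hs).const_mul Real.pi⁻¹
  refine ne_of_eq_of_ne (lintegral_congr_ae ?_) hint.lintegral_lt_top.ne
  filter_upwards [Measure.ae_ne volume (0 : ℂ)] with z hz
  simp only [Pi.mul_apply]
  rw [← ofReal_norm, ENNReal.ofReal_rpow_of_pos (norm_pos_iff.2 hz),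
    ← ENNReal.ofReal_mul (by positivity), mul_assoc, mul_comm (Real.exp _)]

lemma exists_measureReal_cscg_norm_mul_le {s : ℝ} (hs₀ : 0 < s) (hs : s < 2) :
    ∃ C : ℝ, ∀ δ : ℝ, 0 < δ →
      (cscg.prod cscg).real {p : ℂ × ℂ | ‖p.2 * p.1‖ ≤ δ} ≤ C * δ ^ s := by
  set φ : ℂ × ℂ → ENNReal := fun p => ‖p.1‖ₑ ^ (-s) * ‖p.2‖ₑ ^ (-s)
  have hφ : ∫⁻ p, φ p ∂(cscg.prod cscg) ≠ ⊤ := by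
    have h := lintegral_enorm_rpow_neg_cscg_ne_top hs
    have hm : AEMeasurable (fun z : ℂ => ‖z‖ₑ ^ (-s)) cscg := by fun_prop
    exact lintegral_prod_mul hm hm ▸ ENNReal.mul_ne_top h h
  refine ⟨(∫⁻ p, φ p ∂(cscg.prod cscg)).toReal, fun δ hδ => ?_⟩
  rw [← div_inv_eq_mul, ← Real.rpow_neg hδ.le]
  refine measureReal_le_lintegral_div (by fun_prop) hφ (by positivity) fun p hp => ?_
  simp only [φ]
  rw [← ENNReal.ofReal_rpow_of_pos hδ, ← ENNReal.mul_rpow_of_ne_top enorm_ne_top enorm_ne_top,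
    ← enorm_mul, mul_comm, ← ofReal_norm,
    ENNReal.rpow_neg, ENNReal.rpow_neg, ENNReal.inv_le_inv]
  exact ENNReal.rpow_le_rpow (ENNReal.ofReal_le_ofReal hp) hs₀.le

end Gaussian

/-! ### Maximum likelihood as regularized least squares -/

section LeastSquares

open Matrix

variable {m n : Type*} [Fintype m] [Fintype n]

/-- The energy `∑ |x_i|²` of a complex vector. -/
def energy (x : n → ℂ) : ℝ := ∑ i, ‖x i‖ ^ 2

lemma energy_nonneg (x : n → ℂ) : 0 ≤ energy x := Finset.sum_nonneg fun _ _ => by positivity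

lemma energy_zero : energy (0 : n → ℂ) = 0 := by simp [energy]

lemma energy_eq_re (x : n → ℂ) : energy x = (star x ⬝ᵥ x).re := by
  simp only [energy, dotProduct, Complex.re_sum, Complex.sq_norm, Complex.normSq_apply]
  simp

lemma energy_smul (c : ℝ) (x : n → ℂ) : energy ((c : ℂ) • x) = c ^ 2 * energy x := by
  simp [energy, mul_pow, Finset.mul_sum]

lemma energy_neg (x : n → ℂ) : energy (-x) = energy x := by simp [energy]

lemma re_star_dotProduct_comm (x y : n → ℂ) : (star x ⬝ᵥ y).re = (star y ⬝ᵥ x).re := by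
  have h : star (star x ⬝ᵥ y) = star y ⬝ᵥ x := by rw [star_dotProduct, star_star, dotProduct_comm]
  rw [← h, Complex.star_def, Complex.conj_re]

lemma energy_add (x y : n → ℂ) :
    energy (x + y) = energy x + 2 * (star x ⬝ᵥ y).re + energy y := by
  simp only [energy_eq_re, star_add, add_dotProduct, dotProduct_add, Complex.add_re,
    re_star_dotProduct_comm y x]
  ring

lemma norm_le_sqrt_energy (x : n → ℂ) : ‖x‖ ≤ √(energy x) := by
  refine (pi_norm_le_iff_of_nonneg (Real.sqrt_nonneg _)).2 fun i => Real.le_sqrt_of_sq_le ?_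
  exact Finset.single_le_sum (f := fun i => ‖x i‖ ^ 2) (fun _ _ => by positivity)
    (Finset.mem_univ i)

lemma energy_le (x : n → ℂ) : energy x ≤ Fintype.card n * ‖x‖ ^ 2 := by
  have h : ∀ i ∈ Finset.univ, ‖x i‖ ^ 2 ≤ ‖x‖ ^ 2 := fun i _ => by
    gcongr; exact norm_le_pi_norm x i
  simpa [energy] using Finset.sum_le_card_nsmul _ _ _ h

lemma star_mulVec_dotProduct (B : Matrix m n ℂ) (x : n → ℂ) (z : m → ℂ) :
    star (B *ᵥ x) ⬝ᵥ z = star x ⬝ᵥ (Bᴴ *ᵥ z) := by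
  rw [star_mulVec, dotProduct_mulVec]

/-- The cost of explaining `y` as `B f` plus noise of variance `γ`, where the entries of `f` have
variance `1`: up to constants, the negative logarithm of the joint density of `f` and `y`. -/
def lsCost (B : Matrix m n ℂ) (γ : ℝ) (y : m → ℂ) (f : n → ℂ) : ℝ :=
  energy f + energy (y - B *ᵥ f) / γ

lemma energy_residual_le_of_lsCost_le {B B' : Matrix m n ℂ} {γ : ℝ} (hγ : 0 < γ) {y : m → ℂ}
    {f f' : n → ℂ} (h : lsCost B' γ y f' ≤ lsCost B γ y f) :
    energy (y - B' *ᵥ f') ≤ γ * energy f + energy (y - B *ᵥ f) := by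
  have h₁ : energy (y - B' *ᵥ f') / γ ≤ energy f + energy (y - B *ᵥ f) / γ :=
    (le_add_of_nonneg_left (energy_nonneg f')).trans h
  have h₂ := mul_le_mul_of_nonneg_left h₁ hγ.le
  rwa [mul_add, mul_div_cancel₀ _ hγ.ne', mul_div_cancel₀ _ hγ.ne'] at h₂

variable [DecidableEq m]

/-- The covariance matrix `B Bᴴ + γ I` of `B f` plus noise of variance `γ`. -/
def regCov (B : Matrix m n ℂ) (γ : ℝ) : Matrix m m ℂ := B * Bᴴ + (γ : ℂ) • 1

lemma regCov_posDef {m n : Type*} [Finite m] [Fintype n] [DecidableEq m] (B : Matrix m n ℂ)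
    {γ : ℝ} (hγ : 0 < γ) : (regCov B γ).PosDef :=
  PosDef.posSemidef_add (posSemidef_self_mul_conjTranspose B)
    (PosDef.one.smul (by exact_mod_cast hγ))

lemma regCov_mulVec (B : Matrix m n ℂ) (γ : ℝ) (z : m → ℂ) :
    regCov B γ *ᵥ z = B *ᵥ (Bᴴ *ᵥ z) + (γ : ℂ) • z := by
  rw [regCov, add_mulVec, smul_mulVec, one_mulVec, mulVec_mulVec]

lemma det_regCov_unitary_mul {U : Matrix m m ℂ} (hU : U * Uᴴ = 1) (B : Matrix m n ℂ)
    (γ : ℝ) : (regCov (U * B) γ).det = (regCov B γ).det := by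
  have h : regCov (U * B) γ = U * regCov B γ * Uᴴ := by
    simp only [regCov, Matrix.mul_add, Matrix.add_mul, conjTranspose_mul, Matrix.mul_smul,
      Matrix.smul_mul, Matrix.mul_one, hU, Matrix.mul_assoc]
  rw [h, det_mul_right_comm, hU, Matrix.one_mul]

lemma lsCost_regCov_mulVec (B : Matrix m n ℂ) {γ : ℝ} (hγ : γ ≠ 0) (z : m → ℂ) (d : n → ℂ) :
    lsCost B γ (regCov B γ *ᵥ z) (Bᴴ *ᵥ z + d) =
      (star (regCov B γ *ᵥ z) ⬝ᵥ z).re + (energy d + energy (B *ᵥ d) / γ) := by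
  have hresidual : regCov B γ *ᵥ z - B *ᵥ (Bᴴ *ᵥ z + d) = (γ : ℂ) • z + -(B *ᵥ d) := by
    rw [regCov_mulVec, mulVec_add]
    abel
  have hcross : (star (Bᴴ *ᵥ z) ⬝ᵥ d).re = (star z ⬝ᵥ (B *ᵥ d)).re := by
    rw [star_mulVec_dotProduct, conjTranspose_conjTranspose]
  have hquad : (star (regCov B γ *ᵥ z) ⬝ᵥ z).re = energy (Bᴴ *ᵥ z) + γ * energy z := by
    rw [regCov_mulVec, star_add, add_dotProduct, star_mulVec_dotProduct, star_smul, smul_dotProduct,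
      Complex.add_re, energy_eq_re, energy_eq_re]
    simp
  have hscaled : (star ((γ : ℂ) • z) ⬝ᵥ (B *ᵥ d)).re = γ * (star z ⬝ᵥ (B *ᵥ d)).re := by
    rw [star_smul, smul_dotProduct]
    simp
  rw [lsCost, hresidual, energy_add, energy_add, energy_smul, energy_neg, dotProduct_neg,
    Complex.neg_re, hscaled, hcross, hquad]
  field_simp
  ring

theorem isLeast_lsCost (B : Matrix m n ℂ) {γ : ℝ} (hγ : 0 < γ) (y : m → ℂ) :
    IsLeast (Set.range (lsCost B γ y)) (star y ⬝ᵥ ((regCov B γ)⁻¹ *ᵥ y)).re := by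
  set z := (regCov B γ)⁻¹ *ᵥ y with hz
  have hy : regCov B γ *ᵥ z = y := by
    rw [hz, mulVec_mulVec, mul_nonsing_inv _ (regCov_posDef B hγ).det_pos.ne'.isUnit, one_mulVec]
  have hcost := lsCost_regCov_mulVec B hγ.ne' z
  rw [hy] at hcost
  refine ⟨⟨Bᴴ *ᵥ z, ?_⟩, ?_⟩
  · simpa [energy_zero] using hcost 0
  · rintro _ ⟨f, rfl⟩
    rw [← add_sub_cancel (Bᴴ *ᵥ z) f, hcost]
    have h₁ := energy_nonneg (f - Bᴴ *ᵥ z)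
    have h₂ := div_nonneg (energy_nonneg (B *ᵥ (f - Bᴴ *ᵥ z))) hγ.le
    linarith

end LeastSquares

section Receiver

open Matrix

variable {R K : ℕ} {L : Fin K → ℕ} {u : Slot R → Fin K → ℕ} {M : Matrix (Fin R) (Fin R) ℂ}
  {P₁ P₂ : ℝ}

/-- The amplitude with which the vector `Γ (g f)` of faded symbols is received. -/
def gain (P₁ P₂ : ℝ) : ℝ := √(P₁ * P₂ / (P₁ + 1))

lemma gain_nonneg (P₁ P₂ : ℝ) : 0 ≤ gain P₁ P₂ := Real.sqrt_nonneg _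

/-- The total noise at the destination: the amplified noise of the relays and `w`. -/
def noise (P₁ P₂ : ℝ) (M : Matrix (Fin R) (Fin R) ℂ) (ω : Sample R) : Slot R → ℂ := fun t =>
  √(P₂ / (1 + P₁)) * (gammaMatrix M *ᵥ fun j => destFading ω j * ω.2.2.1 j t) t + ω.2.2.2 t

/-- The variance of each coordinate of the noise, given the fadings `g`. -/
def noiseVar (P₁ P₂ : ℝ) (g : Fin R → ℂ) : ℝ := 1 + P₂ / (1 + P₁) * energy g

variable (L u M P₁ P₂) in
/-- The matrix `√(P₁ P₂ / (P₁ + 1)) D^l Γ diag (g)` through which the fadings `f` are received. -/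
def channelMatrix (l : Message L) (g : Fin R → ℂ) : Matrix (Slot R) (Fin R) ℂ :=
  (gain P₁ P₂ : ℂ) • (diagonal (phase L u l) * (gammaMatrix M * diagonal g))

lemma gammaMatrix_mulVec (v : Fin R → ℂ) : gammaMatrix M *ᵥ v = Sum.elim (M *ᵥ v) (M *ᵥ v) :=
  fromRows_mulVec M M v

lemma channelMatrix_mulVec (l : Message L) (g f : Fin R → ℂ) (t : Slot R) :
    (channelMatrix L u M P₁ P₂ l g *ᵥ f) t =
      gain P₁ P₂ * (phase L u l t * (gammaMatrix M *ᵥ (g * f)) t) := by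
  have hg : diagonal g *ᵥ f = g * f := funext (mulVec_diagonal g f)
  rw [channelMatrix, smul_mulVec, ← mulVec_mulVec, ← mulVec_mulVec, hg, Pi.smul_apply,
    mulVec_diagonal, smul_eq_mul]

lemma sqrt_mul_sqrt_eq_gain (hP₁ : 0 ≤ P₁) (hP₂ : 0 ≤ P₂) :
    √(P₂ / (1 + P₁)) * √(P₁ * (2 * R)) = gain P₁ P₂ * √(2 * R) := by
  rw [gain, ← Real.sqrt_mul (by positivity), ← Real.sqrt_mul (by positivity), add_comm 1 P₁]
  congr 1
  ring

lemma destReceived_eq (hR : 0 < R) (hP₁ : 0 ≤ P₁) (hP₂ : 0 ≤ P₂) (l : Message L) (ω : Sample R) :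
    destReceived P₁ P₂ M (sourceVector L u l) ω =
      channelMatrix L u M P₁ P₂ l (destFading ω) *ᵥ ω.1 + noise P₁ P₂ M ω := by
  have hsqrt : (√(P₂ / (1 + P₁)) : ℂ) * √(P₁ * (2 * R)) / √(2 * R) = gain P₁ P₂ := by
    rw [div_eq_iff (sqrt_two_mul_ne_zero hR)]
    exact_mod_cast sqrt_mul_sqrt_eq_gain hP₁ hP₂
  ext t
  simp only [destReceived, relayTransmitted, relayReceived, relayMatrix_mulVec,
    sourceVector_apply, noise, channelMatrix_mulVec, ← hsqrt, Pi.add_apply, Finset.sum_apply,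
    Pi.smul_apply, smul_eq_mul]
  simp only [mulVec, dotProduct, Pi.mul_apply, Finset.mul_sum, ← add_assoc,
    ← Finset.sum_add_distrib]
  congr 1
  exact Finset.sum_congr rfl fun j _ => by ring

lemma channelMatrix_mul_conjTranspose (hR : 0 < R) (hP₁ : 0 ≤ P₁) (hP₂ : 0 ≤ P₂)
    (l : Message L) (g : Fin R → ℂ) :
    channelMatrix L u M P₁ P₂ l g * (channelMatrix L u M P₁ P₂ l g)ᴴ =
      ((P₁ * P₂ * (2 * R) / (P₁ + 1) : ℝ) : ℂ) • (codeword L u M l *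
        diagonal (fun j => ((‖g j‖ ^ 2 : ℝ) : ℂ)) * (codeword L u M l)ᴴ) := by
  have hpower : P₁ * P₂ * (2 * R) / (P₁ + 1) * ((√(2 * R))⁻¹ * (√(2 * R))⁻¹) =
      gain P₁ P₂ * gain P₁ P₂ := by
    rw [gain, ← mul_inv, Real.mul_self_sqrt (by positivity), Real.mul_self_sqrt (by positivity)]
    field_simp
  have hg : diagonal g * (diagonal g)ᴴ = diagonal fun j => ((‖g j‖ ^ 2 : ℝ) : ℂ) := by
    rw [diagonal_conjTranspose, diagonal_mul_diagonal]
    exact congrArg diagonal (funext fun j => by simp [Complex.mul_conj'])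
  have hpower' := congrArg (fun x : ℝ => (x : ℂ)) hpower
  simp only [Complex.ofReal_mul, Complex.ofReal_inv] at hpower'
  rw [codeword_eq, channelMatrix, ← hg]
  simp only [conjTranspose_smul, conjTranspose_mul, Matrix.smul_mul, Matrix.mul_smul, smul_smul,
    Matrix.mul_assoc, Complex.star_def, Complex.conj_ofReal, Complex.conj_inv, ← hpower',
    mul_assoc]

lemma receivedCov_eq (hR : 0 < R) (hP₁ : 0 ≤ P₁) (hP₂ : 0 ≤ P₂) (l : Message L)
    (g : Fin R → ℂ) :
    receivedCov P₁ P₂ (codeword L u M l) g =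
      regCov (channelMatrix L u M P₁ P₂ l g) (noiseVar P₁ P₂ g) := by
  rw [regCov, channelMatrix_mul_conjTranspose hR hP₁ hP₂]
  rfl

lemma det_regCov_channelMatrix (l : Message L) (g : Fin R → ℂ) (γ : ℝ) :
    (regCov (channelMatrix L u M P₁ P₂ l g) γ).det =
      (regCov ((gain P₁ P₂ : ℂ) • (gammaMatrix M * diagonal g)) γ).det := by
  have hU : diagonal (phase L u l) * (diagonal (phase L u l))ᴴ = 1 := by
    rw [diagonal_conjTranspose, diagonal_mul_diagonal, ← diagonal_one]
    exact congrArg diagonal (funext fun t => by simp [Complex.mul_conj', norm_phase])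
  rw [channelMatrix, ← Matrix.mul_smul, det_regCov_unitary_mul hU]

lemma one_le_noiseVar (hP₁ : 0 ≤ P₁) (hP₂ : 0 ≤ P₂) (g : Fin R → ℂ) :
    1 ≤ noiseVar P₁ P₂ g :=
  le_add_of_nonneg_right (mul_nonneg (by positivity) (energy_nonneg g))

theorem exists_lsCost_le_of_likelihood_le (hR : 0 < R) (hP₁ : 0 ≤ P₁) (hP₂ : 0 ≤ P₂)
    {l l' : Message L} {g : Fin R → ℂ} {y : Slot R → ℂ}
    (h : likelihood P₁ P₂ (codeword L u M l) g y ≤ likelihood P₁ P₂ (codeword L u M l') g y)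
    (f : Fin R → ℂ) :
    ∃ f' : Fin R → ℂ, lsCost (channelMatrix L u M P₁ P₂ l' g) (noiseVar P₁ P₂ g) y f' ≤
      lsCost (channelMatrix L u M P₁ P₂ l g) (noiseVar P₁ P₂ g) y f := by
  have hγ : 0 < noiseVar P₁ P₂ g := one_pos.trans_le (one_le_noiseVar hP₁ hP₂ g)
  have hdet : 0 < (regCov (channelMatrix L u M P₁ P₂ l' g) (noiseVar P₁ P₂ g)).det.re :=
    (Complex.pos_iff.1 (regCov_posDef _ hγ).det_pos).1
  unfold likelihood at h
  rw [receivedCov_eq hR hP₁ hP₂, receivedCov_eq hR hP₁ hP₂, det_regCov_channelMatrix l,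
    ← det_regCov_channelMatrix l', div_le_div_iff_of_pos_right (by positivity), Real.exp_le_exp,
    neg_le_neg_iff] at h
  obtain ⟨f', hf'⟩ := (isLeast_lsCost (channelMatrix L u M P₁ P₂ l' g) hγ y).1
  exact ⟨f', hf'.le.trans (h.trans ((isLeast_lsCost _ hγ y).2 ⟨f, rfl⟩))⟩

end Receiver

/-! ### Upper bound for the error rate -/

section FadingBound

open Matrix

lemma exists_norm_mulVec_le {m n : Type*} [Fintype m] [Fintype n] (A : Matrix m n ℂ) :
    ∃ C : ℝ, 0 < C ∧ ∀ v : n → ℂ, ‖A *ᵥ v‖ ≤ C * ‖v‖ :=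
  A.mulVecLin.toContinuousLinearMap.bound

variable {R K : ℕ} {L : Fin K → ℕ} {u : Slot R → Fin K → ℕ} {M : Matrix (Fin R) (Fin R) ℂ}
  {P₁ P₂ A X : ℝ}

lemma exists_norm_noise_le (M : Matrix (Fin R) (Fin R) ℂ) (A : ℝ) :
    ∃ C : ℝ, 0 < C ∧ ∀ P₁ P₂ X : ℝ, P₂ / (1 + P₁) ≤ A → 1 ≤ X → ∀ ω : Sample R, ‖ω‖ ≤ X →
      ‖noise P₁ P₂ M ω‖ ≤ C * X ^ 2 := by
  obtain ⟨C, hC, hΓ⟩ := exists_norm_mulVec_le (gammaMatrix M)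
  refine ⟨√A * C + 1, by positivity, fun P₁ P₂ X hA hX ω hω => ?_⟩
  have hgnw : ‖ω.2‖ ≤ X := (norm_snd_le ω).trans hω
  have hg : ‖ω.2.1‖ ≤ X := (norm_fst_le ω.2).trans hgnw
  have hnw : ‖ω.2.2‖ ≤ X := (norm_snd_le ω.2).trans hgnw
  have hamplified (t) : ‖fun j => destFading ω j * ω.2.2.1 j t‖ ≤ X ^ 2 := by
    refine (pi_norm_le_iff_of_nonneg (by positivity)).2 fun j => ?_
    have hn : ‖ω.2.2.1 j t‖ ≤ X := (norm_le_pi_norm _ t).trans <|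
      (norm_le_pi_norm _ j).trans <| (norm_fst_le ω.2.2).trans hnw
    rw [norm_mul, sq]
    exact mul_le_mul ((norm_le_pi_norm _ j).trans hg) hn (by positivity) (by positivity)
  refine (pi_norm_le_iff_of_nonneg (by positivity)).2 fun t => ?_
  calc ‖noise P₁ P₂ M ω t‖
      ≤ √(P₂ / (1 + P₁)) * ‖(gammaMatrix M *ᵥ fun j => destFading ω j * ω.2.2.1 j t) t‖ +
          ‖ω.2.2.2 t‖ := by
        refine (norm_add_le _ _).trans_eq ?_
        rw [norm_mul, Complex.norm_real, Real.norm_of_nonneg (Real.sqrt_nonneg _)]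
    _ ≤ √A * (C * X ^ 2) + X ^ 2 := by
        gcongr
        · exact (norm_le_pi_norm _ t).trans ((hΓ _).trans (by gcongr; exact hamplified t))
        · exact (norm_le_pi_norm _ t).trans <| (norm_snd_le ω.2.2).trans <| hnw.trans <|
            le_self_pow₀ hX two_ne_zero
    _ = (√A * C + 1) * X ^ 2 := by ring

lemma noiseVar_le (hP₁ : 0 ≤ P₁) (hP₂ : 0 ≤ P₂) (hA : P₂ / (1 + P₁) ≤ A) (hX : 1 ≤ X)
    {g : Fin R → ℂ} (hg : ‖g‖ ≤ X) : noiseVar P₁ P₂ g ≤ (1 + A * R) * X ^ 2 := by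
  have hA₀ : 0 ≤ A := le_trans (by positivity) hA
  have henergy : energy g ≤ R * X ^ 2 := by
    have := energy_le g
    rw [Fintype.card_fin] at this
    exact this.trans (by gcongr)
  calc noiseVar P₁ P₂ g ≤ X ^ 2 + A * (R * X ^ 2) :=
        add_le_add (one_le_pow₀ hX) (mul_le_mul hA henergy (energy_nonneg g) hA₀)
    _ = (1 + A * R) * X ^ 2 := by ring

lemma gain_mul_norm_blockDet_mul_le (l l' : Message L) (g f f' : Fin R → ℂ) (i : Fin R) :
    gain P₁ P₂ * (‖blockDet L u l l' i‖ * ‖(M *ᵥ (g * f)) i‖) ≤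
      2 * ‖channelMatrix L u M P₁ P₂ l g *ᵥ f - channelMatrix L u M P₁ P₂ l' g *ᵥ f'‖ := by
  set d := channelMatrix L u M P₁ P₂ l g *ᵥ f - channelMatrix L u M P₁ P₂ l' g *ᵥ f' with hd
  have helim : gain P₁ P₂ * (blockDet L u l l' i * (M *ᵥ (g * f)) i) =
      phase L u l' (Sum.inr i) * d (Sum.inl i) - phase L u l' (Sum.inl i) * d (Sum.inr i) := by
    simp only [hd, Pi.sub_apply, channelMatrix_mulVec, gammaMatrix_mulVec, Sum.elim_inl,
      Sum.elim_inr, blockDet]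
    ring
  calc gain P₁ P₂ * (‖blockDet L u l l' i‖ * ‖(M *ᵥ (g * f)) i‖)
      = ‖gain P₁ P₂ * (blockDet L u l l' i * (M *ᵥ (g * f)) i)‖ := by
        rw [norm_mul, norm_mul, Complex.norm_real, Real.norm_of_nonneg (gain_nonneg _ _)]
    _ ≤ ‖d (Sum.inl i)‖ + ‖d (Sum.inr i)‖ := by
        rw [helim]
        refine (norm_sub_le _ _).trans_eq ?_
        rw [norm_mul, norm_mul, norm_phase, norm_phase, one_mul, one_mul]
    _ ≤ 2 * ‖d‖ := by
        rw [two_mul]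
        gcongr <;> exact norm_le_pi_norm d _

lemma exists_gain_mul_norm_le (hM : M.det ≠ 0)
    (hsep : ∀ l l' : Message L, l ≠ l' → ∀ i, blockDet L u l l' i ≠ 0) :
    ∃ C : ℝ, 0 < C ∧ ∀ P₁ P₂ : ℝ, ∀ l l' : Message L, l ≠ l' → ∀ g f f' : Fin R → ℂ,
      gain P₁ P₂ * ‖g * f‖ ≤
        C * ‖channelMatrix L u M P₁ P₂ l g *ᵥ f - channelMatrix L u M P₁ P₂ l' g *ᵥ f'‖ := by
  obtain ⟨C, hC⟩ := Finite.exists_le fun q : Message L × Message L × Fin R =>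
    ‖blockDet L u q.1 q.2.1 q.2.2‖⁻¹
  obtain ⟨D, hD, hinv⟩ := exists_norm_mulVec_le M⁻¹
  refine ⟨D * (2 * max C 1), by positivity, fun P₁ P₂ l l' hl g f f' => ?_⟩
  set d := channelMatrix L u M P₁ P₂ l g *ᵥ f - channelMatrix L u M P₁ P₂ l' g *ᵥ f'
  have hgain : 0 ≤ gain P₁ P₂ := gain_nonneg _ _
  have hmul : gain P₁ P₂ * ‖M *ᵥ (g * f)‖ ≤ 2 * max C 1 * ‖d‖ := by
    have hcoord (i) : ‖(gain P₁ P₂ • M *ᵥ (g * f)) i‖ ≤ 2 * max C 1 * ‖d‖ := by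
      have hdet : 0 < ‖blockDet L u l l' i‖ := norm_pos_iff.2 (hsep l l' hl i)
      have h := gain_mul_norm_blockDet_mul_le (P₁ := P₁) (P₂ := P₂) (u := u) (M := M) l l' g f f' i
      rw [Pi.smul_apply, norm_smul, Real.norm_of_nonneg hgain]
      calc gain P₁ P₂ * ‖(M *ᵥ (g * f)) i‖
          = ‖blockDet L u l l' i‖⁻¹ *
              (gain P₁ P₂ * (‖blockDet L u l l' i‖ * ‖(M *ᵥ (g * f)) i‖)) := by field_simp
        _ ≤ max C 1 * (2 * ‖d‖) := by
            gcongr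
            exact (hC (l, l', i)).trans (le_max_left C 1)
        _ = 2 * max C 1 * ‖d‖ := by ring
    rw [← Real.norm_of_nonneg hgain, ← norm_smul]
    exact (pi_norm_le_iff_of_nonneg (by positivity)).2 hcoord
  have hcancel : M⁻¹ *ᵥ (M *ᵥ (g * f)) = g * f := by
    rw [mulVec_mulVec, nonsing_inv_mul _ hM.isUnit, one_mulVec]
  calc gain P₁ P₂ * ‖g * f‖ ≤ gain P₁ P₂ * (D * ‖M *ᵥ (g * f)‖) := by
        have := hinv (M *ᵥ (g * f))
        rw [hcancel] at this
        gcongr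
    _ = D * (gain P₁ P₂ * ‖M *ᵥ (g * f)‖) := by ring
    _ ≤ D * (2 * max C 1 * ‖d‖) := by gcongr
    _ = D * (2 * max C 1) * ‖d‖ := by ring

lemma exists_norm_residual_le (hR : 0 < R) (M : Matrix (Fin R) (Fin R) ℂ) (hA : 0 ≤ A) :
    ∃ C : ℝ, 0 ≤ C ∧ ∀ P₁ P₂ X : ℝ, 0 ≤ P₁ → 0 ≤ P₂ → P₂ / (1 + P₁) ≤ A → 1 ≤ X →
      ∀ l l' : Message L, ∀ ω : Sample R, ‖ω‖ ≤ X →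
      likelihood P₁ P₂ (codeword L u M l) (destFading ω)
        (destReceived P₁ P₂ M (sourceVector L u l) ω) ≤
      likelihood P₁ P₂ (codeword L u M l') (destFading ω)
        (destReceived P₁ P₂ M (sourceVector L u l) ω) →
      ∃ f' : Fin R → ℂ, ‖destReceived P₁ P₂ M (sourceVector L u l) ω -
        channelMatrix L u M P₁ P₂ l' (destFading ω) *ᵥ f'‖ ≤ C * X ^ 2 := by
  obtain ⟨C, hC, hnoise⟩ := exists_norm_noise_le M A
  set D : ℝ := (1 + A * R) * R + 2 * R * C ^ 2
  refine ⟨√D, Real.sqrt_nonneg D, fun P₁ P₂ X hP₁ hP₂ hPA hX l l' ω hω hlik => ?_⟩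
  have hf : ‖ω.1‖ ≤ X := (norm_fst_le ω).trans hω
  have hg : ‖destFading ω‖ ≤ X := (norm_fst_le ω.2).trans ((norm_snd_le ω).trans hω)
  have hγ : 0 < noiseVar P₁ P₂ (destFading ω) := one_pos.trans_le (one_le_noiseVar hP₁ hP₂ _)
  obtain ⟨f', hf'⟩ := exists_lsCost_le_of_likelihood_le hR hP₁ hP₂ hlik ω.1
  have hres := energy_residual_le_of_lsCost_le hγ hf'
  rw [destReceived_eq hR hP₁ hP₂, add_sub_cancel_left] at hres
  refine ⟨f', (norm_le_sqrt_energy _).trans ?_⟩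
  rw [destReceived_eq hR hP₁ hP₂]
  have hsq : (√D * X ^ 2) ^ 2 = (1 + A * R) * X ^ 2 * (R * X ^ 2) + 2 * R * (C * X ^ 2) ^ 2 := by
    rw [mul_pow, Real.sq_sqrt (by positivity)]
    ring
  have hsignal : energy ω.1 ≤ R * X ^ 2 := by
    have := energy_le ω.1
    rw [Fintype.card_fin] at this
    exact this.trans (by gcongr)
  have hnoise' : energy (noise P₁ P₂ M ω) ≤ 2 * R * (C * X ^ 2) ^ 2 := by
    have := energy_le (noise P₁ P₂ M ω)
    rw [Fintype.card_sum, Fintype.card_fin, Nat.cast_add, ← two_mul] at this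
    exact this.trans (by gcongr; exact hnoise P₁ P₂ X hPA hX ω hω)
  refine (Real.sqrt_le_left (by positivity)).2 (hres.trans ?_)
  rw [hsq]
  exact add_le_add (mul_le_mul (noiseVar_le hP₁ hP₂ hPA hX hg) hsignal (energy_nonneg _)
    (by positivity)) hnoise'

theorem exists_gain_mul_norm_fading_le (hR : 0 < R) (hM : M.det ≠ 0)
    (hsep : ∀ l l' : Message L, l ≠ l' → ∀ i, blockDet L u l l' i ≠ 0) (hA : 0 ≤ A) :
    ∃ C : ℝ, 0 < C ∧ ∀ P₁ P₂ X : ℝ, 0 ≤ P₁ → 0 ≤ P₂ → P₂ / (1 + P₁) ≤ A → 1 ≤ X →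
      ∀ l l' : Message L, l ≠ l' → ∀ ω : Sample R, ‖ω‖ ≤ X →
      likelihood P₁ P₂ (codeword L u M l) (destFading ω)
        (destReceived P₁ P₂ M (sourceVector L u l) ω) ≤
      likelihood P₁ P₂ (codeword L u M l') (destFading ω)
        (destReceived P₁ P₂ M (sourceVector L u l) ω) →
      gain P₁ P₂ * ‖destFading ω * ω.1‖ ≤ C * X ^ 2 := by
  obtain ⟨C, hC, hstable⟩ := exists_gain_mul_norm_le hM hsep
  obtain ⟨D, hD, hresidual⟩ := exists_norm_residual_le (L := L) (u := u) hR M hA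
  obtain ⟨E, hE, hnoise⟩ := exists_norm_noise_le M A
  refine ⟨C * (D + E), by positivity, fun P₁ P₂ X hP₁ hP₂ hPA hX l l' hl ω hω hlik => ?_⟩
  obtain ⟨f', hf'⟩ := hresidual P₁ P₂ X hP₁ hP₂ hPA hX l l' ω hω hlik
  refine (hstable P₁ P₂ l l' hl _ _ f').trans ?_
  rw [mul_assoc]
  gcongr
  calc ‖channelMatrix L u M P₁ P₂ l (destFading ω) *ᵥ ω.1 -
        channelMatrix L u M P₁ P₂ l' (destFading ω) *ᵥ f'‖
      = ‖(destReceived P₁ P₂ M (sourceVector L u l) ω -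
          channelMatrix L u M P₁ P₂ l' (destFading ω) *ᵥ f') - noise P₁ P₂ M ω‖ := by
        rw [destReceived_eq hR hP₁ hP₂]
        congr 1
        abel
    _ ≤ D * X ^ 2 + E * X ^ 2 :=
        (norm_sub_le _ _).trans (add_le_add hf' (hnoise P₁ P₂ X hPA hX ω hω))
    _ = (D + E) * X ^ 2 := by ring

end FadingBound

section ErrorRate

variable {R K : ℕ} {L : Fin K → ℕ} {u : Slot R → Fin K → ℕ} {M : Matrix (Fin R) (Fin R) ℂ}
  {P₁ P₂ A : ℝ} {dec : (Fin R → ℂ) → (Slot R → ℂ) → Message L}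

/-- The event that the message `l` is not decoded correctly when it is transmitted. -/
def errorEvent (P₁ P₂ : ℝ) (L : Fin K → ℕ) (u : Slot R → Fin K → ℕ)
    (M : Matrix (Fin R) (Fin R) ℂ) (dec : (Fin R → ℂ) → (Slot R → ℂ) → Message L)
    (l : Message L) : Set (Sample R) :=
  {ω | dec (destFading ω) (destReceived P₁ P₂ M (sourceVector L u l) ω) ≠ l}

lemma blockErrorRate_le {c : ℝ} (hc : 0 ≤ c)
    (h : ∀ l, (sampleLaw R).real (errorEvent P₁ P₂ L u M dec l) ≤ c) :
    blockErrorRate P₁ P₂ L u M dec ≤ c := by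
  refine div_le_of_le_mul₀ (Nat.cast_nonneg _) hc ?_
  refine (Finset.sum_le_sum fun l _ => h l).trans_eq ?_
  rw [Finset.sum_const, nsmul_eq_mul, Finset.card_univ, mul_comm]

lemma exists_measureReal_norm_fading_le (R : ℕ) {s : ℝ} (hs₀ : 0 < s) (hs : s < 2) :
    ∃ C : ℝ, ∀ δ : ℝ, 0 < δ →
      (sampleLaw R).real {ω | ‖destFading ω * ω.1‖ ≤ δ} ≤ (C * δ ^ s) ^ R := by
  obtain ⟨C, hC⟩ := exists_measureReal_cscg_norm_mul_le hs₀ hs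
  refine ⟨C, fun δ hδ => le_of_eq_of_le ?_ (pow_le_pow_left₀ measureReal_nonneg (hC δ hδ) R)⟩
  have hproj : MeasurePreserving (Prod.map id Prod.fst) (sampleLaw R)
      ((Measure.pi fun _ : Fin R => cscg).prod (Measure.pi fun _ : Fin R => cscg)) :=
    (MeasurePreserving.id _).prod measurePreserving_fst
  have hmeas : MeasurableSet {p : (Fin R → ℂ) × (Fin R → ℂ) | ‖p.2 * p.1‖ ≤ δ} :=
    measurableSet_le (by fun_prop) measurable_const
  have hprod := measureReal_prod_pi_forall_mem (ι := Fin R) cscg cscg {p | ‖p.2 * p.1‖ ≤ δ}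
  rw [Fintype.card_fin] at hprod
  rw [← hprod]
  have hset : {p : (Fin R → ℂ) × (Fin R → ℂ) | ∀ j, (p.1 j, p.2 j) ∈
      {q : ℂ × ℂ | ‖q.2 * q.1‖ ≤ δ}} = {p | ‖p.2 * p.1‖ ≤ δ} :=
    Set.ext fun p => (pi_norm_le_iff_of_nonneg hδ.le).symm
  rw [hset, ← hproj.measureReal_preimage hmeas.nullMeasurableSet]
  rfl

lemma exists_measureReal_errorEvent_le (hR : 0 < R) (hM : M.det ≠ 0)
    (hsep : ∀ l l' : Message L, l ≠ l' → ∀ i, blockDet L u l l' i ≠ 0) (hA : 0 ≤ A) (k : ℕ)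
    {s : ℝ} (hs₀ : 0 < s) (hs : s < 2) :
    ∃ C D : ℝ, ∀ P₁ P₂ X : ℝ, 0 ≤ P₁ → 0 ≤ P₂ → P₂ / (1 + P₁) ≤ A → 0 < gain P₁ P₂ → 1 ≤ X →
      ∀ dec, IsMLDecoder P₁ P₂ L u M dec → ∀ l,
      (sampleLaw R).real (errorEvent P₁ P₂ L u M dec l) ≤
        C / X ^ k + (D * (X ^ 2 / gain P₁ P₂) ^ s) ^ R := by
  obtain ⟨B, hB, hfading⟩ := exists_gain_mul_norm_fading_le hR hM hsep hA
  obtain ⟨C, htail⟩ := exists_measureReal_norm_gt_le (sampleLaw R) k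
  obtain ⟨D, hsmall⟩ := exists_measureReal_norm_fading_le R hs₀ hs
  refine ⟨C, D * B ^ s, fun P₁ P₂ X hP₁ hP₂ hPA hgain hX dec hdec l => ?_⟩
  have hX₀ : 0 < X := one_pos.trans_le hX
  have hsub : errorEvent P₁ P₂ L u M dec l ⊆
      {ω | X < ‖ω‖} ∪ {ω | ‖destFading ω * ω.1‖ ≤ B * (X ^ 2 / gain P₁ P₂)} := by
    intro ω hω
    rcases lt_or_ge X ‖ω‖ with hlarge | hbdd
    · exact Or.inl hlarge
    · refine Or.inr ?_
      rw [Set.mem_ofPred_eq, ← mul_div_assoc, le_div_iff₀' hgain]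
      exact hfading P₁ P₂ X hP₁ hP₂ hPA hX l _ (Ne.symm hω) ω hbdd (hdec.maximizes _ _ l)
  refine (measureReal_mono hsub).trans ((measureReal_union_le _ _).trans ?_)
  rw [mul_assoc D, ← Real.mul_rpow hB.le (by positivity)]
  exact add_le_add (htail X hX₀) (hsmall _ (by positivity))

end ErrorRate

/-! ### Lower bound for the error rate -/

section ChangeOfVariables

open Matrix

variable {α β ι : Type*} [MeasurableSpace α] [MeasurableSpace β] [Fintype ι]

lemma det_restrictScalars_toLin' [DecidableEq ι] (W : Matrix ι ι ℂ) :
    LinearMap.det ((toLin' W).restrictScalars ℝ) = ‖W.det‖ ^ 2 := by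
  rw [LinearMap.det_restrictScalars, LinearMap.det_toLin', Algebra.norm_complex_apply,
    Complex.normSq_eq_norm_sq]

lemma volume_preimage_mulVec [DecidableEq ι] {W : Matrix ι ι ℂ} (hW : W.det ≠ 0)
    (s : Set (ι → ℂ)) :
    volume ((W *ᵥ ·) ⁻¹' s) = ENNReal.ofReal ((‖W.det‖ ^ 2)⁻¹) * volume s := by
  have hdet : LinearMap.det ((toLin' W).restrictScalars ℝ) ≠ 0 := by
    rw [det_restrictScalars_toLin']
    exact pow_ne_zero 2 (norm_ne_zero_iff.2 hW)
  have h := Measure.addHaar_preimage_linearMap (volume : Measure (ι → ℂ)) hdet s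
  rwa [det_restrictScalars_toLin', abs_of_nonneg (by positivity)] at h

lemma map_mulVec_volume [DecidableEq ι] {W : Matrix ι ι ℂ} (hW : ‖W.det‖ = 1) :
    (volume : Measure (ι → ℂ)).map (W *ᵥ ·) = volume := by
  have hm : Measurable fun x : ι → ℂ => W *ᵥ x :=
    (Continuous.matrix_mulVec continuous_const continuous_id).measurable
  have hW₀ : W.det ≠ 0 := norm_ne_zero_iff.1 (by rw [hW]; exact one_ne_zero)
  ext s hs
  rw [Measure.map_apply hm hs, volume_preimage_mulVec hW₀, hW]
  simp

/-- The polydisc of radius `ε` in the coordinates in `N` and of radius `1` in the others. -/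
def polydisc [DecidableEq ι] (N : Finset ι) (ε : ℝ) : Set (ι → ℂ) :=
  Set.univ.pi fun k => Metric.closedBall 0 (if k ∈ N then ε else 1)

lemma volume_polydisc [DecidableEq ι] (N : Finset ι) (ε : ℝ) :
    volume (polydisc N ε) =
      ENNReal.ofReal ε ^ (2 * N.card) * (NNReal.pi : ENNReal) ^ Fintype.card ι := by
  simp only [polydisc, volume_pi_pi, Complex.volume_closedBall, Finset.prod_mul_distrib,
    Finset.prod_const, Finset.card_univ, apply_ite ENNReal.ofReal, ENNReal.ofReal_one, ite_pow,
    one_pow, Finset.prod_ite_mem, Finset.univ_inter, pow_mul]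

lemma norm_le_one_of_mem_polydisc [DecidableEq ι] {N : Finset ι} {ε : ℝ} (hε : ε ≤ 1) {v : ι → ℂ}
    (hv : v ∈ polydisc N ε) : ‖v‖ ≤ 1 := by
  refine (pi_norm_le_iff_of_nonneg zero_le_one).2 fun k => ?_
  refine (mem_closedBall_zero_iff.1 (hv k (Set.mem_univ k))).trans ?_
  split_ifs
  exacts [hε, le_rfl]

lemma measurePreserving_prod_of_ae {μ : Measure α} {ν : Measure β} [SFinite μ] [SFinite ν]
    {T : β → α → α} (hT : Measurable (Function.uncurry T)) (hmap : ∀ᵐ b ∂ν, μ.map (T b) = μ) :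
    MeasurePreserving (fun p : α × β => (T p.2 p.1, p.2)) (μ.prod ν) (μ.prod ν) :=
  (Measure.measurePreserving_swap.comp ((MeasurePreserving.id ν).skew_product hT hmap)).comp
    Measure.measurePreserving_swap

lemma measurePreserving_prod_add {γ E : Type*} [MeasurableSpace γ] [AddGroup E]
    [MeasurableSpace E] [MeasurableAdd₂ E] (μ : Measure α) (ν : Measure β) (κ : Measure γ)
    (μE : Measure E) [SFinite μ] [SFinite ν] [SFinite κ] [SFinite μE] [μE.IsAddRightInvariant]
    {s : β × α → E} (hs : Measurable s) :
    MeasurePreserving (fun p : α × β × γ × E => (p.1, p.2.1, p.2.2.1, p.2.2.2 + s (p.2.1, p.1)))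
      (μ.prod (ν.prod (κ.prod μE))) (μ.prod (ν.prod (κ.prod μE))) := by
  have hfiber (a) : MeasurePreserving (fun x : β × γ × E => (x.1, x.2.1, x.2.2 + s (x.1, a)))
      (ν.prod (κ.prod μE)) (ν.prod (κ.prod μE)) := by
    refine (MeasurePreserving.id ν).skew_product
      (g := fun (b : β) (x : γ × E) => (x.1, x.2 + s (b, a))) ?_ (Eventually.of_forall fun b => ?_)
    · simp only [Function.uncurry_def]
      fun_prop
    · exact ((MeasurePreserving.id κ).prod (measurePreserving_add_right μE (s (b, a)))).map_eq
  refine (MeasurePreserving.id μ).skew_product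
    (g := fun (a : α) (x : β × γ × E) => (x.1, x.2.1, x.2.2 + s (x.1, a))) ?_
    (Eventually.of_forall fun a => (hfiber a).map_eq)
  simp only [Function.uncurry_def]
  fun_prop

lemma mul_le_prod_of_forall_le_section {μ : Measure α} {ν : Measure β} [SFinite μ] [SFinite ν]
    {E : Set (α × β)} (hE : MeasurableSet E) {S : Set β} {c : ENNReal}
    (h : ∀ b ∈ S, c ≤ μ ((fun a => (a, b)) ⁻¹' E)) : c * ν S ≤ μ.prod ν E := by
  rw [Measure.prod_apply_symm hE]
  exact (mul_le_mul_right (measure_mono h) c).trans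
    (mul_meas_ge_le_lintegral (measurable_measure_prodMk_right hE) c)

/-- A measure-preserving map which exchanges two hypotheses bounds the two error probabilities of
any test from below: where the first error does not occur, the second one occurs at the image. -/
lemma mul_le_add_of_measurePreserving {μ ν : Measure α} {T : α → α}
    (hT : MeasurePreserving T ν ν) {c : ENNReal} {B F E E' : Set α} (hle : c • ν.restrict B ≤ μ)
    (hB : MeasurableSet B) (hE : MeasurableSet E) (hE' : MeasurableSet E') (hF : F ⊆ B)
    (hTF : Set.MapsTo T F B) (hTE : ∀ x ∈ F, x ∉ E → T x ∈ E') : c * ν F ≤ μ E + μ E' := by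
  have hdom {A : Set α} (hA : MeasurableSet A) : c * ν (A ∩ B) ≤ μ A := by
    simpa [Measure.restrict_apply hA] using hle A
  have hinter : F ∩ E ⊆ E ∩ B := fun x hx => ⟨hx.2, hF hx.1⟩
  have hdiff : F \ E ⊆ T ⁻¹' (E' ∩ B) := fun x hx => ⟨hTE x hx.1 hx.2, hTF hx.1⟩
  calc c * ν F = c * ν (F ∩ E) + c * ν (F \ E) := by rw [← mul_add, measure_inter_add_sdiff _ hE]
    _ ≤ c * ν (E ∩ B) + c * ν (T ⁻¹' (E' ∩ B)) :=
        add_le_add (mul_le_mul_right (measure_mono hinter) c)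
          (mul_le_mul_right (measure_mono hdiff) c)
    _ ≤ μ E + μ E' := by
        rw [hT.measure_preimage (hE'.inter hB).nullMeasurableSet]
        exact add_le_add (hdom hE) (hdom hE')

end ChangeOfVariables

section Swap

open Matrix

variable {R K : ℕ} {L : Fin K → ℕ} {u : Slot R → Fin K → ℕ} {M : Matrix (Fin R) (Fin R) ℂ}
  {P₁ P₂ : ℝ} {l l' : Message L} {g f : Fin R → ℂ}

variable (L u) in
/-- The rotation of the block `i` which turns the first coordinate of `l'` into that of `l`. -/
def turn (l l' : Message L) (i : Fin R) : ℂ := phase L u l (Sum.inl i) / phase L u l' (Sum.inl i)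

lemma norm_turn (i : Fin R) : ‖turn L u l l' i‖ = 1 := by
  rw [turn, norm_div, norm_phase, norm_phase, div_one]

lemma norm_turn_mul (v : Fin R → ℂ) : ‖turn L u l l' * v‖ = ‖v‖ := by
  have h (i) : ‖turn L u l l' i‖₊ = 1 := NNReal.eq (norm_turn i)
  simp only [Pi.norm_def, Pi.mul_apply, nnnorm_mul, h, one_mul]

variable (L u M) in
/-- The linear map of the fadings `f` which rotates the blocks of `M (g f)` by `turn`. -/
def twist (l l' : Message L) (g : Fin R → ℂ) : Matrix (Fin R) (Fin R) ℂ :=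
  diagonal g⁻¹ * (M⁻¹ * diagonal (turn L u l l') * M) * diagonal g

lemma norm_det_twist (hM : M.det ≠ 0) (hg : ∀ j, g j ≠ 0) : ‖(twist L u M l l' g).det‖ = 1 := by
  have hprod : ∏ j, g j ≠ 0 := Finset.prod_ne_zero_iff.2 fun j _ => hg j
  have hdet : (twist L u M l l' g).det = ∏ i, turn L u l l' i := by
    simp only [twist, det_mul, det_diagonal, det_nonsing_inv, Ring.inverse_eq_inv', Pi.inv_apply,
      Finset.prod_inv_distrib]
    field_simp
  rw [hdet, norm_prod]
  exact Finset.prod_eq_one fun i _ => norm_turn i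

lemma twist_mulVec (l l' : Message L) (g f : Fin R → ℂ) :
    twist L u M l l' g *ᵥ f = g⁻¹ * (M⁻¹ *ᵥ (turn L u l l' * (M *ᵥ (g * f)))) := by
  have hdiag (a b : Fin R → ℂ) : diagonal a *ᵥ b = a * b := funext (mulVec_diagonal a b)
  simp only [twist, ← mulVec_mulVec, hdiag]

lemma mulVec_mul_twist (hM : M.det ≠ 0) (hg : ∀ j, g j ≠ 0) (f : Fin R → ℂ) :
    M *ᵥ (g * (twist L u M l l' g *ᵥ f)) = turn L u l l' * (M *ᵥ (g * f)) := by
  have hcancel (v : Fin R → ℂ) : g * (g⁻¹ * v) = v :=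
    funext fun j => mul_inv_cancel_left₀ (hg j) (v j)
  rw [twist_mulVec, hcancel, mulVec_mulVec, mul_nonsing_inv _ hM.isUnit, one_mulVec]

lemma measurable_twist_mulVec (l l' : Message L) :
    Measurable fun p : (Fin R → ℂ) × (Fin R → ℂ) => twist L u M l l' p.1 *ᵥ p.2 := by
  simp only [twist_mulVec]
  have hcont : Continuous fun v : Fin R → ℂ => M⁻¹ *ᵥ (turn L u l l' * (M *ᵥ v)) :=
    continuous_const.matrix_mulVec (continuous_const.mul (continuous_const.matrix_mulVec
      continuous_id))
  exact measurable_fst.inv.mul (hcont.measurable.comp (measurable_fst.mul measurable_snd))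

variable (L u M P₁ P₂) in
/-- The change of the noise which makes up for the difference between the noiseless received
vectors for `l` and `f`, and for `l'` and the twisted `f`. -/
def shift (l l' : Message L) (p : (Fin R → ℂ) × (Fin R → ℂ)) : Slot R → ℂ :=
  Sum.elim 0 fun i =>
    -(gain P₁ P₂ * (blockDet L u l l' i / phase L u l' (Sum.inl i) * (M *ᵥ (p.1 * p.2)) i))

lemma channelMatrix_mulVec_twist_add_shift (hM : M.det ≠ 0) (hg : ∀ j, g j ≠ 0) :
    channelMatrix L u M P₁ P₂ l' g *ᵥ (twist L u M l l' g *ᵥ f) + shift L u M P₁ P₂ l l' (g, f) =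
      channelMatrix L u M P₁ P₂ l g *ᵥ f := by
  ext (i | i) <;>
  · simp only [Pi.add_apply, channelMatrix_mulVec, gammaMatrix_mulVec, mulVec_mul_twist hM hg,
      shift, Sum.elim_inl, Sum.elim_inr, Pi.mul_apply, Pi.zero_apply, turn, blockDet]
    field_simp [phase_ne_zero (L := L) (u := u) l' (Sum.inl i)]
    ring

lemma measurable_shift (l l' : Message L) : Measurable (shift L u M P₁ P₂ l l') := by
  refine measurable_pi_lambda _ (Sum.rec (fun _ => measurable_const) fun i => ?_)
  simp only [shift, Sum.elim_inr, mulVec, dotProduct, Pi.mul_apply]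
  fun_prop

lemma norm_shift_le {N : Finset (Fin R)} (hN : ∀ i ∉ N, blockDet L u l l' i = 0) {ε : ℝ}
    (hgain : gain P₁ P₂ * ε ≤ 1) (hf : M *ᵥ (g * f) ∈ polydisc N ε) :
    ‖shift L u M P₁ P₂ l l' (g, f)‖ ≤ 2 := by
  refine (pi_norm_le_iff_of_nonneg zero_le_two).2 (Sum.rec (fun _ => by simp [shift]) fun i => ?_)
  by_cases hi : i ∈ N
  · have hblock : ‖blockDet L u l l' i‖ ≤ 2 := by
      refine (norm_sub_le _ _).trans_eq ?_
      rw [norm_mul, norm_mul, norm_phase, norm_phase, norm_phase, norm_phase]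
      norm_num
    have hv : ‖(M *ᵥ (g * f)) i‖ ≤ ε := by simpa [hi] using hf i (Set.mem_univ i)
    rw [shift, Sum.elim_inr, norm_neg, norm_mul, norm_mul, norm_div, norm_phase, div_one,
      Complex.norm_of_nonneg (gain_nonneg _ _)]
    calc gain P₁ P₂ * (‖blockDet L u l l' i‖ * ‖(M *ᵥ (g * f)) i‖)
        ≤ gain P₁ P₂ * (2 * ε) := by have := gain_nonneg P₁ P₂; gcongr
      _ ≤ 2 := by linarith
  · simp [shift, hN i hi]

variable (L u M P₁ P₂) in
/-- The change of variables which turns the received vector for `l` into that for `l'`. -/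
def swapMap (l l' : Message L) (ω : Sample R) : Sample R :=
  (twist L u M l l' ω.2.1 *ᵥ ω.1, ω.2.1, ω.2.2.1,
    ω.2.2.2 + shift L u M P₁ P₂ l l' (ω.2.1, ω.1))

lemma destReceived_swapMap (hR : 0 < R) (hM : M.det ≠ 0) (hP₁ : 0 ≤ P₁) (hP₂ : 0 ≤ P₂)
    {ω : Sample R} (hω : ∀ j, destFading ω j ≠ 0) :
    destReceived P₁ P₂ M (sourceVector L u l') (swapMap L u M P₁ P₂ l l' ω) =
      destReceived P₁ P₂ M (sourceVector L u l) ω := by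
  have hnoise : noise P₁ P₂ M (swapMap L u M P₁ P₂ l l' ω) =
      shift L u M P₁ P₂ l l' (destFading ω, ω.1) + noise P₁ P₂ M ω := by
    ext t
    simp only [noise, swapMap, destFading, Pi.add_apply]
    ring
  rw [destReceived_eq hR hP₁ hP₂, destReceived_eq hR hP₁ hP₂, hnoise, ← add_assoc,
    ← channelMatrix_mulVec_twist_add_shift hM hω]
  rfl

lemma measurePreserving_swapMap (hM : M.det ≠ 0) (μ : Measure (Fin R → ℂ))
    (κ : Measure (Fin R → Slot R → ℂ)) [SFinite μ] [SFinite κ] (hμ : ∀ᵐ g ∂μ, ∀ j, g j ≠ 0) :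
    MeasurePreserving (swapMap L u M P₁ P₂ l l')
      (volume.prod (μ.prod (κ.prod volume))) (volume.prod (μ.prod (κ.prod volume))) := by
  have hmeas : Measurable (Function.uncurry
      fun (x : (Fin R → ℂ) × (Fin R → Slot R → ℂ) × (Slot R → ℂ)) (f : Fin R → ℂ) =>
        twist L u M l l' x.1 *ᵥ f) := by
    have hproj : Measurable fun p : ((Fin R → ℂ) × (Fin R → Slot R → ℂ) × (Slot R → ℂ)) ×
        (Fin R → ℂ) => (p.1.1, p.2) := by fun_prop
    simpa only [Function.comp_def, Function.uncurry_def] using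
      (measurable_twist_mulVec (L := L) (u := u) (M := M) l l').comp hproj
  have htwist : ∀ᵐ x ∂μ.prod (κ.prod (volume : Measure (Slot R → ℂ))),
      (volume : Measure (Fin R → ℂ)).map (twist L u M l l' x.1 *ᵥ ·) = volume := by
    filter_upwards [Measure.quasiMeasurePreserving_fst.ae hμ] with x hx
    exact map_mulVec_volume (norm_det_twist hM hx)
  exact (measurePreserving_prod_of_ae hmeas htwist).comp
    (measurePreserving_prod_add volume μ κ volume (measurable_shift l l'))

end Swap

section LowerBound

open Matrix

variable {R K : ℕ} {L : Fin K → ℕ} {u : Slot R → Fin K → ℕ} {M : Matrix (Fin R) (Fin R) ℂ}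
  {P₁ P₂ ε : ℝ} {l l' : Message L} {g f : Fin R → ℂ} {N : Finset (Fin R)}

variable (R) in
/-- The fadings `g` with moduli between `1` and `2`. -/
def annulus : Set (Fin R → ℂ) := {g | ∀ j, 1 ≤ ‖g j‖ ∧ ‖g j‖ ≤ 2}

lemma measurableSet_annulus : MeasurableSet (annulus R) := by
  simp only [annulus, measurableSet_setOfPred]
  fun_prop

lemma ne_zero_of_mem_annulus (hg : g ∈ annulus R) (j : Fin R) : g j ≠ 0 :=
  norm_pos_iff.1 (one_pos.trans_le (hg j).1)

lemma exists_smul_restrict_le_pi_cscg (ι : Type*) [Fintype ι] {r : ℝ} (hr : 0 ≤ r) :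
    ∃ c : ENNReal, c ≠ 0 ∧ c ≠ ⊤ ∧
      c • volume.restrict (Metric.closedBall 0 r) ≤ Measure.pi fun _ : ι => cscg := by
  obtain ⟨c, hc₀, hc, hle⟩ := exists_smul_restrict_le_cscg r
  refine ⟨c ^ Fintype.card ι, pow_ne_zero _ hc₀, ENNReal.pow_ne_top hc, ?_⟩
  rw [closedBall_pi _ hr]
  exact smul_restrict_pi_le hle

lemma pi_cscg_annulus_ne_zero : (Measure.pi fun _ : Fin R => cscg) (annulus R) ≠ 0 := by
  obtain ⟨c, hc₀, -, hle⟩ := exists_smul_restrict_le_pi_cscg (Fin R) zero_le_two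
  set z : Fin R → ℂ := fun _ => 3 / 2
  have hannulus : Metric.ball z (1 / 2) ⊆ annulus R := fun g hg j => by
    have hz : ‖z j‖ = 3 / 2 := by norm_num [z]
    have hdist : ‖g j - z j‖ < 1 / 2 := by
      rw [← dist_eq_norm]
      exact (dist_le_pi_dist g z j).trans_lt hg
    have h := abs_le.1 ((abs_norm_sub_norm_le (g j) (z j)).trans hdist.le)
    rw [hz] at h
    constructor <;> linarith [h.1, h.2]
  have hball : Metric.ball z (1 / 2) ⊆ Metric.closedBall 0 2 := fun g hg =>
    mem_closedBall_zero_iff.2 ((pi_norm_le_iff_of_nonneg zero_le_two).2 fun j => (hannulus hg j).2)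
  refine ne_of_gt (lt_of_lt_of_le ?_ ((hle _).trans (measure_mono hannulus)))
  rw [Measure.smul_apply, Measure.restrict_eq_self _ hball, smul_eq_mul]
  exact ENNReal.mul_pos hc₀ (Metric.measure_ball_pos _ _ (by norm_num)).ne'

variable (R) in
/-- Lebesgue measure in the fadings `f` and in the noise at the destination, the Gaussian law in
the other variables, with `g` restricted to the annulus. -/
def refMeasure : Measure (Sample R) :=
  volume.prod (((Measure.pi fun _ : Fin R => cscg).restrict (annulus R)).prod
    ((Measure.pi fun _ : Fin R => Measure.pi fun _ : Slot R => cscg).prod volume))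

variable (R) in
/-- The samples whose fadings `f` and noise at the destination have norm at most `r`. -/
def boundedRegion (r : ℝ) : Set (Sample R) :=
  Metric.closedBall 0 r ×ˢ (Set.univ ×ˢ (Set.univ ×ˢ Metric.closedBall 0 r))

lemma exists_smul_restrict_refMeasure_le (R : ℕ) {r : ℝ} (hr : 0 ≤ r) :
    ∃ c : ENNReal, c ≠ 0 ∧ c ≠ ⊤ ∧
      c • (refMeasure R).restrict (boundedRegion R r) ≤ sampleLaw R := by
  obtain ⟨a, ha₀, ha, hale⟩ := exists_smul_restrict_le_pi_cscg (Fin R) hr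
  obtain ⟨b, hb₀, hb, hble⟩ := exists_smul_restrict_le_pi_cscg (Slot R) hr
  refine ⟨a * b, mul_ne_zero ha₀ hb₀, ENNReal.mul_ne_top ha hb, ?_⟩
  refine le_of_eq_of_le ?_ (Measure.prod_mono hale
    (Measure.prod_mono (Measure.restrict_le_self (s := annulus R)) (Measure.prod_mono le_rfl hble)))
  rw [Measure.prod_smul_right, Measure.prod_smul_right, Measure.prod_smul_left,
    Measure.prod_smul_right, smul_smul, refMeasure, boundedRegion, ← Measure.prod_restrict,
    ← Measure.prod_restrict, ← Measure.prod_restrict, Measure.restrict_univ, Measure.restrict_univ]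

variable (M) in
/-- The samples for which the blocks in `N` are received at the level `ε` at most. -/
def faded (N : Finset (Fin R)) (ε : ℝ) : Set (Sample R) :=
  {ω | ω.2.1 ∈ annulus R ∧ M *ᵥ (ω.2.1 * ω.1) ∈ polydisc N ε ∧ ‖ω.2.2.2‖ ≤ 1}

lemma measurableSet_faded (N : Finset (Fin R)) (ε : ℝ) : MeasurableSet (faded M N ε) := by
  have hpolydisc : MeasurableSet (polydisc N ε) :=
    MeasurableSet.univ_pi fun _ => Metric.isClosed_closedBall.measurableSet
  have hblocks : Measurable fun ω : Sample R => M *ᵥ (ω.2.1 * ω.1) :=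
    (continuous_const.matrix_mulVec (by fun_prop)).measurable
  exact (measurable_snd.fst measurableSet_annulus).inter
    ((hblocks hpolydisc).inter (measurableSet_le measurable_snd.snd.snd.norm measurable_const))

lemma le_volume_section_faded (hM : M.det ≠ 0) (N : Finset (Fin R)) (ε : ℝ)
    {n : Fin R → Slot R → ℂ} {w : Slot R → ℂ} (hg : g ∈ annulus R) (hw : ‖w‖ ≤ 1) :
    ENNReal.ofReal (((‖M.det‖ * 2 ^ R) ^ 2)⁻¹) *
        (ENNReal.ofReal ε ^ (2 * N.card) * (NNReal.pi : ENNReal) ^ R) ≤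
      volume ((fun f => ((f, g, n, w) : Sample R)) ⁻¹' faded M N ε) := by
  have hg₀ : 0 < ∏ j, ‖g j‖ :=
    Finset.prod_pos fun j _ => norm_pos_iff.2 (ne_zero_of_mem_annulus hg j)
  have hg₂ : ∏ j, ‖g j‖ ≤ 2 ^ R := by
    simpa using Finset.prod_le_prod (s := Finset.univ) (fun j _ => norm_nonneg (g j))
      fun j _ => (hg j).2
  have hdet : ‖(M * diagonal g).det‖ = ‖M.det‖ * ∏ j, ‖g j‖ := by
    rw [det_mul, det_diagonal, norm_mul, norm_prod]
  have : 0 < ‖M.det‖ := norm_pos_iff.2 hM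
  have hpreimage : (fun f => ((f, g, n, w) : Sample R)) ⁻¹' faded M N ε =
      ((M * diagonal g) *ᵥ ·) ⁻¹' polydisc N ε := by
    ext f
    have hdiag : diagonal g *ᵥ f = g * f := funext (mulVec_diagonal g f)
    rw [Set.mem_preimage, Set.mem_preimage, ← mulVec_mulVec, hdiag]
    exact ⟨fun h => h.2.1, fun h => ⟨hg, h, hw⟩⟩
  rw [hpreimage, volume_preimage_mulVec (norm_pos_iff.1 (hdet ▸ by positivity)), volume_polydisc,
    Fintype.card_fin, hdet]
  gcongr

lemma exists_mul_le_refMeasure_faded (hM : M.det ≠ 0) (N : Finset (Fin R)) :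
    ∃ c : ENNReal, c ≠ 0 ∧ c ≠ ⊤ ∧ ∀ ε : ℝ,
      c * ENNReal.ofReal ε ^ (2 * N.card) ≤ refMeasure R (faded M N ε) := by
  set μ := Measure.pi fun _ : Fin R => cscg
  set κ := Measure.pi fun _ : Fin R => Measure.pi fun _ : Slot R => cscg
  set W : Set (Slot R → ℂ) := Metric.closedBall 0 1
  set S : Set ((Fin R → ℂ) × (Fin R → Slot R → ℂ) × (Slot R → ℂ)) :=
    annulus R ×ˢ (Set.univ ×ˢ W) with hS
  have hρS : (μ.restrict (annulus R)).prod (κ.prod volume) S = μ (annulus R) * volume W := by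
    rw [hS, Measure.prod_prod, Measure.prod_prod, Measure.restrict_apply_self, measure_univ,
      one_mul]
  have hW₀ : volume W ≠ 0 := (Metric.measure_closedBall_pos volume _ one_pos).ne'
  have hW : volume W ≠ ⊤ := measure_closedBall_lt_top.ne
  set d := ENNReal.ofReal (((‖M.det‖ * 2 ^ R) ^ 2)⁻¹)
  have hd₀ : d ≠ 0 := by
    have := norm_pos_iff.2 hM
    exact (ENNReal.ofReal_pos.2 (by positivity)).ne'
  have hπ₀ : (NNReal.pi : ENNReal) ≠ 0 := ENNReal.coe_ne_zero.2 NNReal.pi_pos.ne'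
  refine ⟨d * NNReal.pi ^ R * (μ (annulus R) * volume W),
    mul_ne_zero (mul_ne_zero hd₀ (pow_ne_zero _ hπ₀)) (mul_ne_zero pi_cscg_annulus_ne_zero hW₀),
    ENNReal.mul_ne_top (ENNReal.mul_ne_top ENNReal.ofReal_ne_top
      (ENNReal.pow_ne_top ENNReal.coe_ne_top)) (ENNReal.mul_ne_top (measure_ne_top _ _) hW),
    fun ε => ?_⟩
  rw [← hρS]
  refine le_of_eq_of_le (by ring) (mul_le_prod_of_forall_le_section (measurableSet_faded N ε)
    fun (x : _ × _ × _) (hx : x ∈ S) =>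
      le_volume_section_faded hM N ε hx.1 (mem_closedBall_zero_iff.1 hx.2.2))

lemma exists_norm_le_of_mem_annulus (hM : M.det ≠ 0) :
    ∃ C : ℝ, ∀ g ∈ annulus R, ∀ f : Fin R → ℂ, ‖M *ᵥ (g * f)‖ ≤ 1 → ‖f‖ ≤ C := by
  obtain ⟨C, hC, hinv⟩ := exists_norm_mulVec_le M⁻¹
  refine ⟨C, fun g hg f hf => (pi_norm_le_iff_of_nonneg hC.le).2 fun j => ?_⟩
  have hgf : ‖g * f‖ ≤ C := by
    have h := hinv (M *ᵥ (g * f))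
    rw [mulVec_mulVec, nonsing_inv_mul _ hM.isUnit, one_mulVec] at h
    exact h.trans (mul_le_of_le_one_right hC.le hf)
  calc ‖f j‖ ≤ ‖g j‖ * ‖f j‖ := le_mul_of_one_le_left (norm_nonneg _) (hg j).1
    _ = ‖(g * f) j‖ := (norm_mul _ _).symm
    _ ≤ C := (norm_le_pi_norm _ j).trans hgf

lemma exists_faded_subset_mapsTo_swapMap (hM : M.det ≠ 0) :
    ∃ r : ℝ, 0 ≤ r ∧ ∀ P₁ P₂ ε : ℝ, ε ≤ 1 → gain P₁ P₂ * ε ≤ 1 → ∀ N : Finset (Fin R),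
      ∀ l l' : Message L, (∀ i ∉ N, blockDet L u l l' i = 0) →
      faded M N ε ⊆ boundedRegion R r ∧
        Set.MapsTo (swapMap L u M P₁ P₂ l l') (faded M N ε) (boundedRegion R r) := by
  obtain ⟨C, hC⟩ := exists_norm_le_of_mem_annulus hM
  have hle := le_max_left C 3
  have hle' := le_max_right C 3
  refine ⟨max C 3, zero_le_three.trans hle', fun P₁ P₂ ε hε hgain N l l' hN => ⟨?_, ?_⟩⟩
  all_goals
    rintro ω ⟨hg, hf, hw⟩
    have hv := norm_le_one_of_mem_polydisc hε hf
    refine ⟨mem_closedBall_zero_iff.2 (hle.trans' (hC _ hg _ ?_)), Set.mem_univ _, Set.mem_univ _,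
      mem_closedBall_zero_iff.2 (hle'.trans' ?_)⟩
  · exact hv
  · exact hw.trans (by norm_num)
  · rwa [swapMap, mulVec_mul_twist hM (ne_zero_of_mem_annulus hg), norm_turn_mul]
  · exact (norm_add_le _ _).trans (by linarith [norm_shift_le hN hgain hf])

lemma measurable_destReceived (P₁ P₂ : ℝ) (M : Matrix (Fin R) (Fin R) ℂ) (s : Slot R → ℂ) :
    Measurable (destReceived P₁ P₂ M s) := by
  refine measurable_pi_lambda _ fun t => ?_
  simp only [destReceived, destFading, relayTransmitted, relayReceived, relayMatrix_mulVec,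
    Pi.add_apply, Finset.sum_apply, Pi.smul_apply, smul_eq_mul]
  fun_prop

lemma measurableSet_errorEvent {dec : (Fin R → ℂ) → (Slot R → ℂ) → Message L}
    (hdec : Measurable (Function.uncurry dec)) (l : Message L) :
    MeasurableSet (errorEvent P₁ P₂ L u M dec l) :=
  hdec.comp (measurable_snd.fst.prodMk (measurable_destReceived P₁ P₂ M (sourceVector L u l)))
    (measurableSet_singleton l).compl

theorem exists_le_measureReal_errorEvent_add (hR : 0 < R) (hM : M.det ≠ 0) (hl : l ≠ l')
    (hN : ∀ i ∉ N, blockDet L u l l' i = 0) :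
    ∃ c : ℝ, 0 < c ∧ ∀ P₁ P₂ ε : ℝ, 0 ≤ P₁ → 0 ≤ P₂ → 0 ≤ ε → ε ≤ 1 → gain P₁ P₂ * ε ≤ 1 →
      ∀ dec : (Fin R → ℂ) → (Slot R → ℂ) → Message L, Measurable (Function.uncurry dec) →
      c * ε ^ (2 * N.card) ≤ (sampleLaw R).real (errorEvent P₁ P₂ L u M dec l) +
        (sampleLaw R).real (errorEvent P₁ P₂ L u M dec l') := by
  obtain ⟨r, hr, hregion⟩ := exists_faded_subset_mapsTo_swapMap (L := L) (u := u) hM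
  obtain ⟨a, ha₀, ha, hale⟩ := exists_smul_restrict_refMeasure_le R hr
  obtain ⟨b, hb₀, hb, hble⟩ := exists_mul_le_refMeasure_faded hM N
  refine ⟨(a * b).toReal, ENNReal.toReal_pos (mul_ne_zero ha₀ hb₀) (ENNReal.mul_ne_top ha hb),
    fun P₁ P₂ ε hP₁ hP₂ hε₀ hε hgain dec hdec => ?_⟩
  obtain ⟨hsub, hmaps⟩ := hregion P₁ P₂ ε hε hgain N l l' hN
  have hswap : MeasurePreserving (swapMap L u M P₁ P₂ l l') (refMeasure R) (refMeasure R) :=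
    measurePreserving_swapMap hM _ _
      ((ae_restrict_mem measurableSet_annulus).mono fun g hg => ne_zero_of_mem_annulus hg)
  have hB : MeasurableSet (boundedRegion R r) :=
    Metric.isClosed_closedBall.measurableSet.prod (MeasurableSet.univ.prod
      (MeasurableSet.univ.prod Metric.isClosed_closedBall.measurableSet))
  have hconfused (ω) (hω : ω ∈ faded M N ε) (hcorrect : ω ∉ errorEvent P₁ P₂ L u M dec l) :
      swapMap L u M P₁ P₂ l l' ω ∈ errorEvent P₁ P₂ L u M dec l' := by
    change dec (destFading ω) (destReceived P₁ P₂ M _ (swapMap L u M P₁ P₂ l l' ω)) ≠ l'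
    rw [destReceived_swapMap hR hM hP₁ hP₂ (ne_zero_of_mem_annulus hω.1),
      show dec _ _ = l from not_not.1 hcorrect]
    exact hl
  have hsum := mul_le_add_of_measurePreserving hswap hale hB (measurableSet_errorEvent hdec l)
    (measurableSet_errorEvent hdec l') hsub hmaps hconfused
  have hvolume := (mul_le_mul_right (hble ε) a).trans hsum
  rw [← mul_assoc] at hvolume
  have := ENNReal.toReal_mono (by finiteness) hvolume
  rwa [ENNReal.toReal_mul, ENNReal.toReal_pow, ENNReal.toReal_ofReal hε₀,
    ENNReal.toReal_add (measure_ne_top _ _) (measure_ne_top _ _)] at this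

lemma div_card_le_blockErrorRate {dec : (Fin R → ℂ) → (Slot R → ℂ) → Message L} {c : ℝ}
    (hl : l ≠ l') (h : c ≤ (sampleLaw R).real (errorEvent P₁ P₂ L u M dec l) +
      (sampleLaw R).real (errorEvent P₁ P₂ L u M dec l')) :
    c / Fintype.card (Message L) ≤ blockErrorRate P₁ P₂ L u M dec := by
  refine div_le_div_of_nonneg_right (h.trans ?_) (Nat.cast_nonneg _)
  rw [← Finset.sum_pair (f := fun m => (sampleLaw R).real (errorEvent P₁ P₂ L u M dec m)) hl]
  exact Finset.sum_le_univ_sum_of_nonneg fun m => measureReal_nonneg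

end LowerBound

/-! ### Diversity order -/

section Diversity

lemma isLittleO_rpow_rpow_atTop {a b : ℝ} (h : a < b) :
    (fun x : ℝ => x ^ a) =o[atTop] fun x => x ^ b := by
  refine (Asymptotics.isLittleO_iff_tendsto' ?_).2 ?_
  · filter_upwards [eventually_gt_atTop 0] with x hx hzero
    exact absurd hzero (Real.rpow_pos_of_pos hx b).ne'
  · refine (tendsto_rpow_neg_atTop (sub_pos.2 h)).congr' ?_
    filter_upwards [eventually_gt_atTop 0] with x hx
    rw [neg_sub, Real.rpow_sub hx]

lemma neg_log_div_log_lt_iff {x p t : ℝ} (hx : 1 < x) (hp : 0 < p) :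
    -Real.log p / Real.log x < t ↔ x ^ (-t) < p := by
  rw [div_lt_iff₀ (Real.log_pos hx), Real.rpow_lt_iff_lt_log (one_pos.trans hx) hp, neg_mul,
    neg_lt]

lemma lt_neg_log_div_log_iff {x p t : ℝ} (hx : 1 < x) (hp : 0 < p) :
    t < -Real.log p / Real.log x ↔ p < x ^ (-t) := by
  rw [lt_div_iff₀ (Real.log_pos hx), Real.lt_rpow_iff_log_lt hp (one_pos.trans hx), neg_mul,
    lt_neg]

variable {p : ℝ → ℝ} {d s t : ℝ}

lemma eventually_neg_log_div_log_lt (hp : ∀ᶠ P in atTop, 0 < p P)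
    (hlower : (fun P : ℝ => P ^ (-s)) =O[atTop] p) (hst : s < t) :
    ∀ᶠ P in atTop, -Real.log (p P) / Real.log P < t := by
  have hlt := ((isLittleO_rpow_rpow_atTop (neg_lt_neg hst)).trans_isBigO hlower)
    |>.eventuallyLT_norm_of_eventually_pos (hp.mono fun _ hpP => norm_pos_iff.2 hpP.ne')
  filter_upwards [hlt, hp, eventually_gt_atTop 1] with P hPt hpP hP
  rw [Real.norm_of_nonneg hpP.le] at hPt
  exact (neg_log_div_log_lt_iff hP hpP).2 ((Real.le_norm_self _).trans_lt hPt)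

lemma eventually_lt_neg_log_div_log (hp : ∀ᶠ P in atTop, 0 < p P)
    (hupper : p =O[atTop] fun P : ℝ => P ^ (-s)) (hts : t < s) :
    ∀ᶠ P in atTop, t < -Real.log (p P) / Real.log P := by
  have hlt := (hupper.trans_isLittleO (isLittleO_rpow_rpow_atTop (neg_lt_neg hts)))
    |>.eventuallyLT_norm_of_eventually_pos ((eventually_gt_atTop 0).mono fun P hP =>
      norm_pos_iff.2 (Real.rpow_pos_of_pos hP _).ne')
  filter_upwards [hlt, hp, eventually_gt_atTop 1] with P hPt hpP hP
  rw [Real.norm_of_nonneg (Real.rpow_nonneg (zero_lt_one.trans hP).le _)] at hPt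
  exact (lt_neg_log_div_log_iff hP hpP).2 ((Real.le_norm_self _).trans_lt hPt)

lemma HasDiversityOrder.le_of_isBigO (h : HasDiversityOrder p d)
    (hlower : (fun P : ℝ => P ^ (-s)) =O[atTop] p) : d ≤ s :=
  le_of_forall_gt_imp_ge_of_dense fun _ hst =>
    (le_of_tendsto h.2 ((eventually_neg_log_div_log_lt h.1 hlower hst).mono fun _ => le_of_lt))

lemma hasDiversityOrder_of_isBigO (hp : ∀ P, 0 ≤ p P)
    (hlower : (fun P : ℝ => P ^ (-d)) =O[atTop] p)
    (hupper : ∀ s < d, p =O[atTop] fun P : ℝ => P ^ (-s)) : HasDiversityOrder p d := by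
  have hpos : ∀ᶠ P in atTop, 0 < p P := by
    filter_upwards [hlower.eq_zero_imp, eventually_gt_atTop 0] with P hzero hP
    exact (hp P).lt_of_ne' (mt hzero (Real.rpow_pos_of_pos hP _).ne')
  refine ⟨hpos, tendsto_order.2 ⟨fun t htd => ?_, fun t hdt => ?_⟩⟩
  · obtain ⟨s, hts, hsd⟩ := exists_between htd
    exact eventually_lt_neg_log_div_log hpos (hupper s hsd) hts
  · exact eventually_neg_log_div_log_lt hpos hlower hdt

end Diversity

section PowerAllocation

variable {R K : ℕ} {L : Fin K → ℕ} {u : Slot R → Fin K → ℕ} {M : Matrix (Fin R) (Fin R) ℂ}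
  {α P : ℝ}

lemma sourcePower_nonneg (hα : 0 ≤ α) (hP : 0 ≤ P) : 0 ≤ sourcePower α P := mul_nonneg hα hP

lemma relayPower_nonneg (R : ℕ) (hα : α ≤ 1) (hP : 0 ≤ P) : 0 ≤ relayPower R α P :=
  div_nonneg (mul_nonneg (sub_nonneg.2 hα) hP) (Nat.cast_nonneg R)

lemma relayPower_le (R : ℕ) (hα₀ : 0 ≤ α) (hα₁ : α ≤ 1) (hP : 0 ≤ P) : relayPower R α P ≤ P := by
  have hshare : (1 - α) * P ≤ P := mul_le_of_le_one_left hP (sub_le_self 1 hα₀)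
  rcases R.eq_zero_or_pos with rfl | hR
  · simpa only [relayPower, Nat.cast_zero, div_zero]
  · exact (div_le_self (mul_nonneg (sub_nonneg.2 hα₁) hP) (by exact_mod_cast hR)).trans hshare

lemma relayPower_div_le (R : ℕ) (hα₀ : 0 < α) (hα₁ : α ≤ 1) (hP : 0 ≤ P) :
    relayPower R α P / (1 + sourcePower α P) ≤ 1 / α := by
  have hαP := sourcePower_nonneg hα₀.le hP
  rw [div_le_div_iff₀ (by positivity) hα₀]
  calc relayPower R α P * α ≤ P * α := by gcongr; exact relayPower_le R hα₀.le hα₁ hP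
    _ = sourcePower α P := mul_comm _ _
    _ ≤ 1 * (1 + sourcePower α P) := by linarith

lemma gain_le_sqrt (R : ℕ) (hα₀ : 0 ≤ α) (hα₁ : α ≤ 1) (hP : 0 ≤ P) :
    gain (sourcePower α P) (relayPower R α P) ≤ √P := by
  have hαP := sourcePower_nonneg hα₀ hP
  refine Real.sqrt_le_sqrt ((div_le_iff₀ (by positivity)).2 ?_)
  calc sourcePower α P * relayPower R α P ≤ sourcePower α P * P := by
        gcongr
        exact relayPower_le R hα₀ hα₁ hP
    _ ≤ P * (sourcePower α P + 1) := by linarith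

lemma sqrt_mul_le_gain (R : ℕ) (hα₀ : 0 ≤ α) (hα₁ : α ≤ 1) (hP : 1 ≤ P) :
    √(α * (1 - α) / (2 * R) * P) ≤ gain (sourcePower α P) (relayPower R α P) := by
  have hP₀ : 0 ≤ P := zero_le_one.trans hP
  have hαP := sourcePower_nonneg hα₀ hP₀
  have : 0 ≤ α * (1 - α) := mul_nonneg hα₀ (sub_nonneg.2 hα₁)
  have hsource : sourcePower α P + 1 ≤ 2 * P := by
    linarith [show sourcePower α P ≤ P from mul_le_of_le_one_left hP₀ hα₁]
  refine Real.sqrt_le_sqrt ((le_div_iff₀ (by positivity)).2 ?_)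
  calc α * (1 - α) / (2 * R) * P * (sourcePower α P + 1)
      ≤ α * (1 - α) / (2 * R) * P * (2 * P) := by gcongr
    _ = sourcePower α P * relayPower R α P := by
      rw [sourcePower, relayPower]
      ring

lemma gain_pos (hR : 0 < R) (hα₀ : 0 < α) (hα₁ : α < 1) (hP : 1 ≤ P) :
    0 < gain (sourcePower α P) (relayPower R α P) := by
  have : 0 < 1 - α := sub_pos.2 hα₁
  exact (Real.sqrt_pos.2 (by positivity)).trans_le (sqrt_mul_le_gain R hα₀.le hα₁.le hP)

lemma isBigO_inv_gain (hR : 0 < R) (hα₀ : 0 < α) (hα₁ : α < 1) :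
    (fun P => (gain (sourcePower α P) (relayPower R α P))⁻¹) =O[atTop]
      fun P : ℝ => P ^ (-(1 / 2 : ℝ)) := by
  have : 0 < 1 - α := sub_pos.2 hα₁
  refine .of_bound (√(α * (1 - α) / (2 * R)))⁻¹ ?_
  filter_upwards [eventually_ge_atTop 1] with P hP
  have hP₀ : 0 < P := one_pos.trans_le hP
  rw [Real.norm_of_nonneg (inv_nonneg.2 (gain_nonneg _ _)), Real.norm_of_nonneg (by positivity),
    Real.rpow_neg hP₀.le, ← Real.sqrt_eq_rpow, ← mul_inv, ← Real.sqrt_mul' _ hP₀.le]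
  gcongr
  exact sqrt_mul_le_gain R hα₀.le hα₁.le hP

lemma blockErrorRate_nonneg (P₁ P₂ : ℝ) (L : Fin K → ℕ) (u : Slot R → Fin K → ℕ)
    (M : Matrix (Fin R) (Fin R) ℂ) (dec : (Fin R → ℂ) → (Slot R → ℂ) → Message L) :
    0 ≤ blockErrorRate P₁ P₂ L u M dec :=
  div_nonneg (Finset.sum_nonneg fun _ _ => measureReal_nonneg) (Nat.cast_nonneg _)

variable {dec : ℝ → (Fin R → ℂ) → (Slot R → ℂ) → Message L}

lemma exists_exponent_le {r s : ℝ} (hr : 0 < r) (hs : s < r) :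
    ∃ ε : ℝ, 0 < ε ∧ ε < 2 ∧ (ε * 2 + -(1 / 2)) * (2 - ε) * r ≤ -s := by
  refine ⟨min 1 ((r - s) / (5 * r)), lt_min one_pos (div_pos (sub_pos.2 hs) (by positivity)),
    (min_le_left _ _).trans_lt one_lt_two, ?_⟩
  have hεs := min_le_right 1 ((r - s) / (5 * r))
  set ε := min 1 ((r - s) / (5 * r))
  rw [le_div_iff₀ (by positivity)] at hεs
  nlinarith [sq_nonneg ε]

lemma isBigO_rpow_sq_div_gain (hR : 0 < R) (hα₀ : 0 < α) (hα₁ : α < 1) (ε : ℝ) :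
    (fun P => (P ^ ε) ^ 2 / gain (sourcePower α P) (relayPower R α P)) =O[atTop]
      fun P : ℝ => P ^ (ε * 2 + -(1 / 2)) := by
  refine ((Asymptotics.isBigO_refl (fun P : ℝ => (P ^ ε) ^ 2) atTop).mul
    (isBigO_inv_gain hR hα₀ hα₁)).congr' .rfl ?_
  filter_upwards [eventually_gt_atTop 0] with P hP
  rw [Real.rpow_add hP, Real.rpow_mul hP.le, Real.rpow_two]

lemma isBigO_errorBound (hR : 0 < R) (hα₀ : 0 < α) (hα₁ : α < 1) {s ε : ℝ} {k : ℕ}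
    (hε : ε < 2) (hexponent : (ε * 2 + -(1 / 2)) * (2 - ε) * R ≤ -s) (hk : s ≤ k * ε) (C D : ℝ) :
    (fun P => C / (P ^ ε) ^ k +
        (D * ((P ^ ε) ^ 2 / gain (sourcePower α P) (relayPower R α P)) ^ (2 - ε)) ^ R) =O[atTop]
      fun P : ℝ => P ^ (-s) := by
  have hmono {a : ℝ} (ha : a ≤ -s) : (fun P : ℝ => P ^ a) =O[atTop] fun P => P ^ (-s) := by
    refine .of_bound' ?_
    filter_upwards [eventually_ge_atTop 1] with P hP
    rw [Real.norm_of_nonneg (by positivity), Real.norm_of_nonneg (by positivity)]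
    exact Real.rpow_le_rpow_of_exponent_le hP ha
  refine .add ?_ ?_
  · refine ((Asymptotics.isBigO_refl _ _).const_mul_left C).congr' (.refl ..) ?_ |>.trans
      (hmono (a := -(ε * k)) (by linarith))
    filter_upwards [eventually_gt_atTop 0] with P hP
    rw [Real.rpow_neg hP.le, Real.rpow_mul hP.le, Real.rpow_natCast]
  · have hratio := ((isBigO_rpow_sq_div_gain hR hα₀ hα₁ ε).rpow (sub_pos.2 hε).le
      ((eventually_ge_atTop 0).mono fun P hP => Real.rpow_nonneg hP _)).const_mul_left D |>.pow R
    refine (hratio.congr' .rfl ?_).trans (hmono hexponent)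
    filter_upwards [eventually_gt_atTop 0] with P hP
    rw [← Real.rpow_mul hP.le, ← Real.rpow_natCast, ← Real.rpow_mul hP.le]

theorem isBigO_blockErrorRate (hR : 0 < R) (hM : M.det ≠ 0)
    (hsep : ∀ l l' : Message L, l ≠ l' → ∀ i, blockDet L u l l' i ≠ 0) (hα₀ : 0 < α) (hα₁ : α < 1)
    (hdec : ∀ᶠ P in atTop, IsMLDecoder (sourcePower α P) (relayPower R α P) L u M (dec P))
    {s : ℝ} (hs : s < R) :
    (fun P => blockErrorRate (sourcePower α P) (relayPower R α P) L u M (dec P)) =O[atTop]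
      fun P : ℝ => P ^ (-s) := by
  obtain ⟨ε, hε₀, hε, hexponent⟩ := exists_exponent_le (Nat.cast_pos.2 hR) hs
  obtain ⟨k, hk⟩ := exists_nat_ge (s / ε)
  obtain ⟨C, D, herror⟩ := exists_measureReal_errorEvent_le hR hM hsep (one_div_pos.2 hα₀).le k
    (sub_pos.2 hε) (sub_lt_self 2 hε₀)
  refine .trans (.of_bound' ?_)
    (isBigO_errorBound hR hα₀ hα₁ hε hexponent ((div_le_iff₀ hε₀).1 hk) C D)
  filter_upwards [hdec, eventually_ge_atTop 1] with P hdecP hP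
  have hP₀ : 0 ≤ P := zero_le_one.trans hP
  have hevent := herror (sourcePower α P) (relayPower R α P) (P ^ ε)
    (sourcePower_nonneg hα₀.le hP₀) (relayPower_nonneg R hα₁.le hP₀)
    (relayPower_div_le R hα₀ hα₁.le hP₀) (gain_pos hR hα₀ hα₁ hP)
    (Real.one_le_rpow hP hε₀.le) (dec P) hdecP
  rw [Real.norm_of_nonneg (blockErrorRate_nonneg ..)]
  exact blockErrorRate_le (norm_nonneg _) fun l => (hevent l).trans (Real.le_norm_self _)

theorem rpow_isBigO_blockErrorRate (hR : 0 < R) (hM : M.det ≠ 0) {l l' : Message L} (hl : l ≠ l')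
    {N : Finset (Fin R)} (hN : ∀ i ∉ N, blockDet L u l l' i = 0) (hα₀ : 0 ≤ α) (hα₁ : α ≤ 1)
    (hdec : ∀ᶠ P in atTop, Measurable (Function.uncurry (dec P))) :
    (fun P : ℝ => P ^ (-(N.card : ℝ))) =O[atTop]
      fun P => blockErrorRate (sourcePower α P) (relayPower R α P) L u M (dec P) := by
  obtain ⟨c, hc, hlower⟩ := exists_le_measureReal_errorEvent_add hR hM hl hN
  have : Nonempty (Message L) := ⟨l⟩
  refine .of_bound (c / Fintype.card (Message L))⁻¹ ?_
  filter_upwards [hdec, eventually_ge_atTop 1] with P hdecP hP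
  have hP₀ : 0 < P := one_pos.trans_le hP
  have hsqrt : 0 < √P := Real.sqrt_pos.2 hP₀
  have herror := div_card_le_blockErrorRate hl <| hlower (sourcePower α P) (relayPower R α P) (√P)⁻¹
    (sourcePower_nonneg hα₀ hP₀.le) (relayPower_nonneg R hα₁ hP₀.le) (inv_nonneg.2 hsqrt.le)
    (inv_le_one_of_one_le₀ (Real.one_le_sqrt.2 hP))
    (by rw [← div_eq_mul_inv, div_le_one hsqrt]; exact gain_le_sqrt R hα₀ hα₁ hP₀.le)
    (dec P) hdecP
  rw [Real.norm_of_nonneg (by positivity), Real.norm_of_nonneg (blockErrorRate_nonneg ..),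
    le_inv_mul_iff₀ (by positivity), Real.rpow_neg hP₀.le, Real.rpow_natCast]
  rwa [pow_mul, inv_pow, Real.sq_sqrt hP₀.le, inv_pow, mul_div_right_comm] at herror

end PowerAllocation

end RelayNetwork

end

theorem theorem2_general {R K : ℕ} (hR : 0 < R) (L : Fin K → ℕ) [Nontrivial (Message L)]
    (u : Slot R → Fin K → ℕ) (M : Matrix (Fin R) (Fin R) ℂ) (hM : M.det ≠ 0)
    (α : ℝ) (hα₀ : 0 < α) (hα₁ : α < 1)
    (dec : ℝ → (Fin R → ℂ) → (Slot R → ℂ) → Message L)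
    (hdec : ∀ᶠ P in atTop, IsMLDecoder (sourcePower α P) (relayPower R α P) L u M (dec P)) :
    (HasDiversityOrder
        (fun P => blockErrorRate (sourcePower α P) (relayPower R α P) L u M (dec P)) (R : ℝ) ↔
      ∀ i : Fin R, ∀ l l' : Message L, l ≠ l' →
        ¬ ∃ z : ℤ, ∑ ν, (((l ν : ℕ) : ℝ) - ((l' ν : ℕ) : ℝ)) *
          ((u (Sum.inl i) ν : ℝ) - (u (Sum.inr i) ν : ℝ)) / (L ν : ℝ) = (z : ℝ)) ∧
    (DetCriterion L u M ↔
      ∀ i : Fin R, ∀ l l' : Message L, l ≠ l' →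
        ¬ ∃ z : ℤ, ∑ ν, (((l ν : ℕ) : ℝ) - ((l' ν : ℕ) : ℝ)) *
          ((u (Sum.inl i) ν : ℝ) - (u (Sum.inr i) ν : ℝ)) / (L ν : ℝ) = (z : ℝ)) := by
  simp only [← blockDet_eq_zero_iff]
  have hmeas := hdec.mono fun P hdecP => hdecP.measurable
  refine ⟨⟨fun hdiv i l l' hl hzero => ?_, fun hsep => ?_⟩, ?_⟩
  · have hN : ∀ j ∉ Finset.univ.erase i, blockDet L u l l' j = 0 := fun j hj => by
      rwa [show j = i by simpa using hj]
    have hle := hdiv.le_of_isBigO (rpow_isBigO_blockErrorRate hR hM hl hN hα₀.le hα₁.le hmeas)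
    rw [Nat.cast_le, Finset.card_erase_of_mem (Finset.mem_univ i), Finset.card_fin] at hle
    omega
  · obtain ⟨l, l', hl⟩ := exists_pair_ne (Message L)
    have hlower := rpow_isBigO_blockErrorRate (N := Finset.univ) (u := u) hR hM hl
      (fun i hi => absurd (Finset.mem_univ i) hi) hα₀.le hα₁.le hmeas
    rw [Finset.card_fin] at hlower
    exact hasDiversityOrder_of_isBigO (fun P => blockErrorRate_nonneg ..) hlower fun s =>
      isBigO_blockErrorRate hR hM (fun l l' hl i => hsep i l l' hl) hα₀ hα₁ hdec
  · rw [detCriterion_iff hR hM]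
    exact ⟨fun h i l l' hl => h l l' hl i, fun h l l' hl i => h i l l' hl⟩

theorem theorem2 {R K : ℕ} (hR : 0 < R) (hK : 0 < K)
    (L : Fin K → ℕ) (u : Slot R → Fin K → ℕ)
    (hu : ∀ t ν, 1 ≤ u t ν ∧ u t ν ≤ L ν - 1)
    (M : Matrix (Fin R) (Fin R) ℂ) (hM : IsGBH M)
    (α : ℝ) (hα₀ : 0 < α) (hα₁ : α < 1)
    (dec : ℝ → (Fin R → ℂ) → (Slot R → ℂ) → Message L)
    (hdec : ∀ P : ℝ, 0 < P →
      IsMLDecoder (sourcePower α P) (relayPower R α P) L u M (dec P)) :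
    (HasDiversityOrder
        (fun P => blockErrorRate (sourcePower α P) (relayPower R α P) L u M (dec P)) (R : ℝ) ↔
      ∀ i : Fin R, ∀ l l' : Message L, l ≠ l' →
        ¬ ∃ z : ℤ, ∑ ν, (((l ν : ℕ) : ℝ) - ((l' ν : ℕ) : ℝ)) *
          ((u (Sum.inl i) ν : ℝ) - (u (Sum.inr i) ν : ℝ)) / (L ν : ℝ) = (z : ℝ)) ∧
    (DetCriterion L u M ↔
      ∀ i : Fin R, ∀ l l' : Message L, l ≠ l' →
        ¬ ∃ z : ℤ, ∑ ν, (((l ν : ℕ) : ℝ) - ((l' ν : ℕ) : ℝ)) *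
          ((u (Sum.inl i) ν : ℝ) - (u (Sum.inr i) ν : ℝ)) / (L ν : ℝ) = (z : ℝ)) := by
  have := nontrivial_message (L := L) hK fun ν => by
    have := hu (Sum.inl ⟨0, hR⟩) ν
    omega
  exact theorem2_general hR L u M hM.det_ne_zero α hα₀ hα₁ dec ((eventually_gt_atTop 0).mono hdec)
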